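/- Let \(n,\ell\) be positive integers with \(\ell\le n\) and \(\alpha>0\). The labelled exclusion process on the complete graph with vertex set \(V\), \(|V|=n\), with \(\ell\) labelled balls and intensity \(\alpha\), is the continuous-time Markov chain \(\{X_t\}_{t\ge 0}\) on the set \((V)_\ell\) of ordered \(\ell\)-tuples of distinct elements of \(V\) with generator \(Q=[q_{x,x'}]\) given by \(q_{x,x}=-\alpha\left(\ell(n-\ell)+\binom{\ell}{2}\right)\), \(q_{x,x'}=\alpha\) if \(x\) and \(x'\) differ in exactly one coordinate or \(x'\) is obtained from \(x\) by interchanging two of its coordinates, and \(q_{x,x'}=0\) otherwise. Let \(\pi\) be its stationary distribution, and put \(\|\nu\|_2^2=\sum_{s}|\nu(s)/\pi(s)|^2\,\pi(s)\) for a signed measure \(\nu\) on \((V)_\ell\), and \(\tau_2(\delta)=\inf\{t\ge 0:\max_{x_0}\|\mathbb P_{x_0}(X_t\in\cdot)-\pi\|_2\le 2\delta\}\). Theorem. Take \(\alpha=2/n^2\), let \(\varepsilon>0\) and assume \(1\le\ell\le(1-\varepsilon)n/2\). For \(c\in\mathbb R\) put \(t=\tfrac14 n\log(\ell(n-1))+cn\).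 (1) For every \(c\in\mathbb R\) with \(t\ge 0\) and every starting state \(x_0\), \(\;e^{-2c}\le\|\mathbb P_{x_0}(X_t\in\cdot)-\pi\|_2\). (2) There is \(N=N(\varepsilon)\), independent of \(\ell\), \(c\) and \(x_0\), such that for every \(n\ge N\), every \(c\ge 0\) and every \(x_0\), \(\;\|\mathbb P_{x_0}(X_t\in\cdot)-\pi\|_2\le 2e^{-2c}\). (3) For every \(\delta\in(0,1)\) there is a constant \(C(\delta)\), depending only on \(\delta\), such that for all \(n\ge N(\varepsilon)\) (with \(N(\varepsilon)\) as in (2), enlarged if necessary, and independent of \(\ell\) and \(\delta\)), \[\left|\tau_2(\delta)-\tfrac14 n\log(\ell n)\right|\le C(\delta)\,n.\] -/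

import Mathlib

/-- The law at time `t` of the continuous time Markov chain on the finite set `S` with generator `Q`
started at `x₀`, as a mass function: the row of `exp (t Q)` indexed by `x₀`. -/
noncomputable def ctmcLaw {S : Type*} [Fintype S] [DecidableEq S] (Q : Matrix S S ℝ)
    (x₀ : S) (t : ℝ) : S → ℝ :=
  fun y => NormedSpace.exp (t • Q) x₀ y

/-- `π` is a stationary distribution for the generator `Q`: a probability mass function with
`π Q = 0`. -/
def IsStationaryDistribution {S : Type*} [Fintype S] (Q : Matrix S S ℝ) (π : S → ℝ) : Prop :=
  π ∈ stdSimplex ℝ S ∧ Matrix.vecMul π Q = 0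

/-- The `L²(π)` norm of a signed measure `ν` on a finite set (both given by mass functions):
`‖ν‖₂² = ∑ |ν(s) / π(s)|² π(s)`. -/
noncomputable def l2Norm {S : Type*} [Fintype S] (π ν : S → ℝ) : ℝ :=
  Real.sqrt (∑ s, |ν s / π s| ^ 2 * π s)

/-- The `L²` distance from `π` of the law at time `t` of the chain started at `x₀`. -/
noncomputable def l2Dist {S : Type*} [Fintype S] [DecidableEq S] (Q : Matrix S S ℝ) (π : S → ℝ)
    (x₀ : S) (t : ℝ) : ℝ :=
  l2Norm π (ctmcLaw Q x₀ t - π)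

/-- The `L²` mixing time
`τ₂(δ) = inf {t ≥ 0 : max over x₀ of ‖P_{x₀}(X_t ∈ ·) - π‖₂ is at most 2δ}`. -/
noncomputable def l2MixingTime {S : Type*} [Fintype S] [DecidableEq S] (Q : Matrix S S ℝ)
    (π : S → ℝ) (δ : ℝ) : ℝ :=
  sInf {t : ℝ | 0 ≤ t ∧ ∀ x₀ : S, l2Dist Q π x₀ t ≤ 2 * δ}

/-- States of the labelled exclusion process on the complete graph with `n` vertices:
ordered `ℓ`-tuples of distinct vertices, `x i` being the position of ball `i`. -/
abbrev LEPState (n ℓ : ℕ) : Type := Fin ℓ ↪ Fin n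

/-- `x` and `x'` differ for exactly one ball. -/
def DifferForOneBall {n ℓ : ℕ} (x x' : LEPState n ℓ) : Prop :=
  ∃! i : Fin ℓ, x i ≠ x' i

/-- `x'` is obtained from `x` by interchanging two of its elements. -/
def DifferByInterchange {n ℓ : ℕ} (x x' : LEPState n ℓ) : Prop :=
  ∃ i j : Fin ℓ, i ≠ j ∧ ∀ k : Fin ℓ, x' k = x (Equiv.swap i j k)

open Classical in
/-- The generator of the labelled exclusion process with `n` vertices, `ℓ` labelled balls and
intensity `α`. -/
noncomputable def lepGenerator (n ℓ : ℕ) (α : ℝ) : Matrix (LEPState n ℓ) (LEPState n ℓ) ℝ :=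
  fun x x' =>
    if x = x' then -α * ((ℓ : ℝ) * ((n : ℝ) - (ℓ : ℝ)) + (ℓ.choose 2 : ℝ))
    else if DifferForOneBall x x' ∨ DifferByInterchange x x' then α
    else 0

/-!
The chain is symmetric and the permutations of the vertices act transitively on its states. Hence
its stationary distribution is uniform, and the squared `L²` distance at time `t` is
`∑ exp (2 t μ) - 1` over all eigenvalues `μ` of the generator with multiplicity
(`l2Dist_uniform_eq_sqrt`). Both bounds are bounds on this sum.

The generator is `α / 2` times the sum of `f ∘ swap a b - f` over ordered pairs of vertices, so it
commutes with taking marginals on a subset of the balls (`marginal_mulVec`). An eigenfunction with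
nonzero eigenvalue has a first level `j` at which some `j`-ball marginal does not vanish. That
marginal is an eigenfunction of the same operator with `j` balls, and its sums over one coordinate
are `(j - 1)`-ball marginals, hence zero. On such functions the moves of single balls act as a
scalar, while the interchanges of balls form an operator of norm at most `j (j - 1) / 2`; so the
eigenvalue is at most `-α j (n - j + 1)` (`lepGenerator_eigenvalue_le`). A function is orthogonal
to the levels up to `k` exactly when its `k`-ball marginals vanish, which is at most
`(ℓ choose k) n ^ k` linear conditions; this bounds the number of eigenvalues above
`-α (k + 1) (n - k)` (`card_eigenvalues_gt_le_choose_mul_pow`).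

For the upper bound, the resulting sum over levels (`sum_exp_eigenvalues_le`) has, at
`t = n log (ℓ (n - 1)) / 4 + c n`, its `k`-th term bounded by about
`exp (-4 c) n ^ (2 k (k - 1) / n) / k!`. For `k ≤ ℓ ≤ (1 - ε) n / 2` and large `n` the factorial
wins, and the terms with `k ≥ 1` sum to at most `4 exp (-4 c)` (`level_sum_le`). For the lower
bound, the functions `∑ i, c i (x i)` with zero row sums span a space of dimension `ℓ (n - 1)`
on which the generator is `-α n`, and these eigenvalues alone contribute `exp (-4 c)`
(`le_sum_exp_eigenvalues`). The statement on the mixing time follows by solving both bounds for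
`c` (`abs_l2MixingTime_sub_le`).
-/

open scoped Matrix

/-! ### Hermitian matrices: traces of exponentials and counting eigenvalues -/

section Hermitian

variable {X : Type*} [Fintype X] [DecidableEq X]

theorem Matrix.IsHermitian.trace_exp_smul {A : Matrix X X ℝ} (hA : A.IsHermitian) (s : ℝ) :
    (NormedSpace.exp (s • A)).trace = ∑ i, Real.exp (s * hA.eigenvalues i) := by
  set U : Matrix X X ℝ := (hA.eigenvectorUnitary : Matrix X X ℝ) with hU
  have hUU : U * star U = 1 := Unitary.coe_mul_star_self hA.eigenvectorUnitary
  have hUU' : star U * U = 1 := Unitary.coe_star_mul_self hA.eigenvectorUnitary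
  have hinv : U⁻¹ = star U := Matrix.inv_eq_left_inv hUU'
  have hunit : IsUnit U := ⟨⟨U, star U, hUU, hUU'⟩, rfl⟩
  have hs : s • A = U * Matrix.diagonal (fun i => s * hA.eigenvalues i) * U⁻¹ := by
    have h := hA.spectral_theorem
    rw [Unitary.conjStarAlgAut_apply] at h
    rw [hinv]
    conv_lhs => rw [h]
    have hd : (Matrix.diagonal (fun i => s * hA.eigenvalues i) : Matrix X X ℝ)
        = s • Matrix.diagonal (RCLike.ofReal ∘ hA.eigenvalues) := by
      ext i j
      simp [Matrix.diagonal_apply]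
    rw [hd, Matrix.mul_smul, Matrix.smul_mul]
  rw [hs, Matrix.exp_conj _ _ hunit, Matrix.trace_mul_comm, ← Matrix.mul_assoc, hinv, hUU',
    Matrix.one_mul, Matrix.exp_diagonal, Matrix.trace_diagonal]
  refine Finset.sum_congr rfl fun i _ => ?_
  rw [Pi.exp_def, Real.exp_eq_exp_ℝ]

theorem Matrix.exp_mulVec_of_mulVec_eq_zero {A : Matrix X X ℝ} {v : X → ℝ}
    (h : A *ᵥ v = 0) : NormedSpace.exp A *ᵥ v = v := by
  have hJ : SemiconjBy (Matrix.of fun x (_ : X) => v x) 0 A := by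
    ext x y
    simpa [Matrix.mul_apply, Matrix.mulVec, dotProduct] using (congrFun h x).symm
  have hJ' : SemiconjBy (Matrix.of fun x (_ : X) => v x)
      (NormedSpace.exp 0) (NormedSpace.exp A) := by
    open scoped Matrix.Norms.Operator in exact hJ.exp_right
  ext x
  have := congrFun (congrFun hJ'.eq x) x
  rw [NormedSpace.exp_zero, mul_one] at this
  simpa [Matrix.mul_apply, Matrix.mulVec, dotProduct] using this.symm

theorem Matrix.exp_apply_of_equiv {A : Matrix X X ℝ} (e : X ≃ X)
    (h : ∀ x y, A (e x) (e y) = A x y) (x y : X) :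
    NormedSpace.exp A (e x) (e y) = NormedSpace.exp A x y := by
  have hA : Matrix.reindexAlgEquiv ℝ ℝ e.symm A = A := by
    ext x y
    simp [h]
  have hc : Continuous (Matrix.reindexAlgEquiv ℝ ℝ e.symm) := by
    refine continuous_matrix fun i j => ?_
    simpa using continuous_id.matrix_elem (e i) (e j)
  have : Matrix.reindexAlgEquiv ℝ ℝ e.symm (NormedSpace.exp A)
      = NormedSpace.exp (Matrix.reindexAlgEquiv ℝ ℝ e.symm A) := by
    open scoped Matrix.Norms.Operator in
    exact NormedSpace.map_exp (Matrix.reindexAlgEquiv ℝ ℝ e.symm) hc A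
  rw [hA] at this
  have h2 := congrFun (congrFun this x) y
  simpa using h2

/-- If `ker Φ` is invariant under the Hermitian matrix `A` and every eigenvector of `A` in
`ker Φ` has eigenvalue at most `γ`, then at most as many eigenvalues exceed `γ` as the codomain
of `Φ` has dimensions: `Φ` is injective on the span of the corresponding eigenvectors. -/
theorem Matrix.IsHermitian.card_eigenvalues_gt_le {A : Matrix X X ℝ} (hA : A.IsHermitian)
    {G : Type*} [AddCommGroup G] [Module ℝ G] [FiniteDimensional ℝ G] (Φ : (X → ℝ) →ₗ[ℝ] G)
    (hinv : ∀ f, Φ f = 0 → Φ (A *ᵥ f) = 0) (γ : ℝ)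
    (h : ∀ f μ, f ≠ 0 → A *ᵥ f = μ • f → Φ f = 0 → μ ≤ γ) :
    (Finset.univ.filter fun i => γ < hA.eigenvalues i).card ≤ Module.finrank ℝ G := by
  set v : X → X → ℝ := fun i => ⇑(hA.eigenvectorBasis i) with hv
  have hAv : ∀ i, A *ᵥ v i = hA.eigenvalues i • v i := hA.mulVec_eigenvectorBasis
  have hli : LinearIndependent ℝ v := by
    have := hA.eigenvectorBasis.orthonormal.linearIndependent
    exact this.map' (WithLp.linearEquiv 2 ℝ (X → ℝ)).toLinearMap (LinearEquiv.ker _)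
  have hAsum : ∀ c : X → ℝ, A *ᵥ (∑ i, c i • v i) = ∑ i, (hA.eigenvalues i * c i) • v i := by
    intro c
    rw [Matrix.mulVec_sum]
    refine Finset.sum_congr rfl fun i _ => ?_
    rw [Matrix.mulVec_smul, hAv, smul_smul, mul_comm]
  -- Applying `A - μ i` removes the `i`-th coordinate and preserves `ker Φ`.
  have key : ∀ J : Finset X, (∀ i ∈ J, γ < hA.eigenvalues i) → ∀ c : X → ℝ,
      (∀ i ∉ J, c i = 0) → Φ (∑ i, c i • v i) = 0 → c = 0 := by
    intro J
    induction J using Finset.induction_on with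
    | empty => exact fun _ c hc _ => funext fun i => hc i (by simp)
    | insert i J hi ih =>
      intro hJ c hc hΦ
      set μ := hA.eigenvalues i with hμ
      have hc' : (fun j => (hA.eigenvalues j - μ) * c j) = 0 := by
        refine ih (fun j hj => hJ j (Finset.mem_insert_of_mem hj)) _ (fun j hj => ?_) ?_
        · by_cases hji : j = i
          · simp [hji, hμ]
          · simp [hc j (by simp [hji, hj])]
        · have h1 := hinv _ hΦ
          rw [hAsum] at h1
          have h2 : ∑ j, ((hA.eigenvalues j - μ) * c j) • v j
              = ∑ j, (hA.eigenvalues j * c j) • v j - μ • ∑ j, c j • v j := by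
            rw [Finset.smul_sum, ← Finset.sum_sub_distrib]
            refine Finset.sum_congr rfl fun j _ => ?_
            rw [sub_mul, sub_smul, smul_smul]
          rw [h2, map_sub, map_smul, h1, hΦ, smul_zero, sub_zero]
      by_contra hne
      have hf : ∑ j, c j • v j ≠ 0 := fun h0 =>
        hne (funext fun j => Fintype.linearIndependent_iff.1 hli c h0 j)
      have heig : A *ᵥ (∑ j, c j • v j) = μ • ∑ j, c j • v j := by
        rw [hAsum, Finset.smul_sum]
        refine Finset.sum_congr rfl fun j _ => ?_
        have := congrFun hc' j
        simp only [Pi.zero_apply] at this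
        rw [smul_smul]
        congr 1
        linarith
      exact absurd (h _ _ hf heig hΦ) (not_le.2 (hJ i (Finset.mem_insert_self i J)))
  set I := Finset.univ.filter fun i => γ < hA.eigenvalues i with hI
  have hliI : LinearIndependent ℝ (fun i : I => Φ (v i)) := by
    rw [Fintype.linearIndependent_iff]
    intro g hg
    let c : X → ℝ := fun i => if hi : i ∈ I then g ⟨i, hi⟩ else 0
    have hsum : ∑ i, c i • v i = ∑ i : I, g i • v i := by
      rw [← Finset.sum_subset (Finset.subset_univ I)
        (fun i _ hi => by simp [c, hi]), ← Finset.sum_coe_sort]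
      exact Finset.sum_congr rfl fun i _ => by simp [c]
    have hc0 : c = 0 := by
      refine key I (fun i hi => (Finset.mem_filter.1 hi).2) c (fun i hi => by simp [c, hi]) ?_
      rw [hsum, map_sum, ← hg]
      exact Finset.sum_congr rfl fun i _ => map_smul _ _ _
    intro i
    have := congrFun hc0 i
    simpa [c] using this
  simpa using hliI.fintype_card_le_finrank

/-- The number of eigenvalues of a Hermitian matrix equal to `μ` is at least the dimension of any
space that embeds into the eigenspace of `μ`. -/
theorem Matrix.IsHermitian.finrank_le_card_eigenvalues_eq {A : Matrix X X ℝ} (hA : A.IsHermitian)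
    {W : Type*} [AddCommGroup W] [Module ℝ W] (φ : W →ₗ[ℝ] (X → ℝ))
    (hφ : Function.Injective φ) (μ : ℝ) (h : ∀ w, A *ᵥ φ w = μ • φ w) :
    Module.finrank ℝ W ≤ (Finset.univ.filter fun i => hA.eigenvalues i = μ).card := by
  set b := hA.eigenvectorBasis
  set I := Finset.univ.filter fun i => hA.eigenvalues i = μ with hI
  let toE : (X → ℝ) →ₗ[ℝ] EuclideanSpace ℝ X := (WithLp.linearEquiv 2 ℝ (X → ℝ)).symm.toLinearMap
  let ρ : W →ₗ[ℝ] (I → ℝ) :=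
    (LinearMap.funLeft ℝ ℝ (Subtype.val : I → X)) ∘ₗ
      (WithLp.linearEquiv 2 ℝ (X → ℝ)).toLinearMap ∘ₗ b.repr.toLinearEquiv.toLinearMap ∘ₗ toE ∘ₗ φ
  have hρ : ∀ w (i : I), ρ w i = b.repr (toE (φ w)) i := fun w i => rfl
  have hcoef : ∀ w i, hA.eigenvalues i * b.repr (toE (φ w)) i = μ * b.repr (toE (φ w)) i := by
    intro w i
    have hrepr : b.repr (toE (φ w)) i = ⇑(b i) ⬝ᵥ φ w := by
      rw [b.repr_apply_apply, EuclideanSpace.inner_eq_star_dotProduct, dotProduct_comm]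
      rfl
    rw [hrepr, ← smul_eq_mul, ← smul_eq_mul, ← smul_dotProduct, ← dotProduct_smul, ← h w,
      ← hA.mulVec_eigenvectorBasis, dotProduct_comm, Matrix.dotProduct_mulVec, dotProduct_comm,
      ← Matrix.mulVec_transpose, dotProduct_comm, ← Matrix.conjTranspose_eq_transpose_of_trivial,
      hA.eq, dotProduct_comm]
  have hinj : Function.Injective ρ := by
    rw [injective_iff_map_eq_zero]
    intro w hw
    have h0 : b.repr (toE (φ w)) = 0 := by
      ext i
      by_cases hi : hA.eigenvalues i = μ
      · have := congrFun hw ⟨i, by simp [hI, hi]⟩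
        rwa [hρ] at this
      · have := hcoef w i
        have h2 : (hA.eigenvalues i - μ) * b.repr (toE (φ w)) i = 0 := by linarith
        exact (mul_eq_zero.1 h2).resolve_left (sub_ne_zero.2 hi)
    have h1 : toE (φ w) = 0 := by simpa using h0
    have h2 : φ w = 0 := by simpa [toE] using h1
    exact (injective_iff_map_eq_zero φ).1 hφ w h2
  simpa using LinearMap.finrank_le_finrank_of_injective hinj

end Hermitian

/-! ### The `L²` distance of a symmetric transitive chain -/

section TransitiveChain

variable {X : Type*} [Fintype X] [DecidableEq X]

/-- For a symmetric transitive chain the return probability does not depend on the state, hence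
the squared `L²` distance to the uniform distribution is the trace of the semigroup at time `2t`
minus one. -/
theorem l2Dist_uniform_eq_sqrt [Nonempty X] {A : Matrix X X ℝ} (hA : A.IsHermitian)
    (h1 : A *ᵥ (fun _ => 1) = 0)
    (htrans : ∀ x y, ∃ e : X ≃ X, e x = y ∧ ∀ z w, A (e z) (e w) = A z w) (x₀ : X) (t : ℝ) :
    l2Dist A (fun _ => (Fintype.card X : ℝ)⁻¹) x₀ t
      = Real.sqrt (∑ i, Real.exp (2 * t * hA.eigenvalues i) - 1) := by
  set M : ℝ := (Fintype.card X : ℝ) with hM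
  have hM0 : M ≠ 0 := by simp [hM]
  have hrow : ∑ y, NormedSpace.exp (t • A) x₀ y = 1 := by
    have h0 : (t • A) *ᵥ (fun _ => (1 : ℝ)) = 0 := by rw [Matrix.smul_mulVec, h1, smul_zero]
    have := congrFun (Matrix.exp_mulVec_of_mulVec_eq_zero h0) x₀
    simpa [Matrix.mulVec, dotProduct] using this
  have hsymm : (NormedSpace.exp (t • A))ᵀ = NormedSpace.exp (t • A) := by
    rw [← Matrix.exp_transpose, Matrix.transpose_smul]
    rw [show Aᵀ = A from hA.eq]
  have hdiag : NormedSpace.exp ((2 * t) • A) x₀ x₀ = ∑ y, (NormedSpace.exp (t • A) x₀ y) ^ 2 := by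
    rw [two_mul, add_smul, Matrix.exp_add_of_commute _ _ (Commute.refl _), Matrix.mul_apply]
    refine Finset.sum_congr rfl fun y _ => ?_
    rw [sq]
    congr 1
    exact congrFun (congrFun hsymm x₀) y
  have htr : M * NormedSpace.exp ((2 * t) • A) x₀ x₀
      = ∑ i, Real.exp (2 * t * hA.eigenvalues i) := by
    rw [← hA.trace_exp_smul, Matrix.trace]
    have : ∀ x, (NormedSpace.exp ((2 * t) • A)).diag x = NormedSpace.exp ((2 * t) • A) x₀ x₀ := by
      intro x
      obtain ⟨e, rfl, he⟩ := htrans x₀ x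
      exact Matrix.exp_apply_of_equiv e (fun z w => by simp [he]) x₀ x₀
    rw [Finset.sum_congr rfl fun x _ => this x]
    simp [hM]
  unfold l2Dist l2Norm ctmcLaw
  rw [← htr, hdiag]
  congr 1
  have : ∀ s, |(((fun y => NormedSpace.exp (t • A) x₀ y) - fun _ => M⁻¹) : X → ℝ) s / M⁻¹| ^ 2 * M⁻¹
      = M * NormedSpace.exp (t • A) x₀ s ^ 2 - 2 * NormedSpace.exp (t • A) x₀ s + M⁻¹ := by
    intro s
    rw [sq_abs, Pi.sub_apply]
    field_simp
    ring
  rw [Finset.sum_congr rfl fun s _ => this s, Finset.sum_add_distrib, Finset.sum_sub_distrib,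
    ← Finset.mul_sum, ← Finset.mul_sum, hrow]
  simp [← hM, hM0]
  ring

end TransitiveChain

/-! ### The generator as a sum over transpositions -/

/-- `∑_{a, b} (f (swap a b ∘ y) - f y)`, the sum over ordered pairs: every transposition of the
values is counted twice, and the pairs `a = b` contribute zero. -/
noncomputable def transpositionOp {ι : Type*} {n : ℕ} (f : (ι → Fin n) → ℝ) (y : ι → Fin n) : ℝ :=
  ∑ a, ∑ b, (f (Equiv.swap a b ∘ y) - f y)

section Pairs

variable {ι : Type*} [Fintype ι] {n : ℕ}

theorem sum_eq_sum_range_add_sum_notMem (y : ι ↪ Fin n) (F : Fin n → ℝ) :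
    ∑ a, F a = ∑ i, F (y i) + ∑ a with a ∉ Set.range y, F a := by
  classical
  rw [← Finset.sum_filter_add_sum_filter_not Finset.univ (fun a => a ∈ Set.range y)]
  congr 1
  rw [← Finset.sum_map Finset.univ y F]
  refine Finset.sum_congr ?_ fun _ _ => rfl
  ext a
  simp

theorem card_filter_notMem_range (y : ι ↪ Fin n) :
    ((Finset.univ.filter fun a => a ∉ Set.range y).card : ℝ) = n - Fintype.card ι := by
  have := sum_eq_sum_range_add_sum_notMem y (fun _ => 1)
  simp only [Finset.sum_const, Finset.card_univ, nsmul_eq_mul, mul_one, Fintype.card_fin] at this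
  linarith

/-- A sum over pairs, split according to which of the two entries lie in the range of `y`. -/
theorem sum_pairs_eq (y : ι ↪ Fin n) (F : Fin n → Fin n → ℝ) :
    ∑ a, ∑ b, F a b = ∑ i, ∑ j, F (y i) (y j)
      + ∑ i, ∑ b with b ∉ Set.range y, (F (y i) b + F b (y i))
      + ∑ a with a ∉ Set.range y, ∑ b with b ∉ Set.range y, F a b := by
  simp only [sum_eq_sum_range_add_sum_notMem y, Finset.sum_add_distrib]
  rw [Finset.sum_comm (s := Finset.univ) (t := Finset.univ.filter fun a => a ∉ Set.range y)
    (f := fun i b => F b (y i))]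
  ring

end Pairs

section Generator

variable {n ℓ : ℕ}

theorem exists_swap_smul_eq_iff {x x' : LEPState n ℓ} (hne : x ≠ x') :
    (∃ a b : Fin n, Equiv.swap a b • x = x') ↔ DifferForOneBall x x' ∨ DifferByInterchange x x' := by
  constructor
  · rintro ⟨a, b, rfl⟩
    have one : ∀ (i : Fin ℓ) (b : Fin n), b ∉ Set.range x →
        DifferForOneBall x (Equiv.swap (x i) b • x) := by
      intro i b hb
      refine ⟨i, ?_, fun k hk => ?_⟩
      · simpa using fun h => hb ⟨i, h⟩
      · by_contra hki
        refine hk ?_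
        simp only [Function.Embedding.smul_apply, Equiv.Perm.smul_def]
        rw [Equiv.swap_apply_of_ne_of_ne (fun h => hki (x.injective h)) (fun h => hb ⟨k, h⟩)]
    by_cases ha : a ∈ Set.range x <;> by_cases hb : b ∈ Set.range x
    · obtain ⟨i, rfl⟩ := ha
      obtain ⟨j, rfl⟩ := hb
      refine Or.inr ⟨i, j, fun hij => hne (by subst hij; rw [Equiv.swap_self]; rfl), fun k => ?_⟩
      simpa using x.injective.swap_apply i j k
    · obtain ⟨i, rfl⟩ := ha
      exact Or.inl (one i b hb)
    · obtain ⟨j, rfl⟩ := hb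
      rw [Equiv.swap_comm]
      exact Or.inl (one j a ha)
    · refine absurd ?_ hne
      ext k
      simp only [Function.Embedding.smul_apply, Equiv.Perm.smul_def]
      rw [Equiv.swap_apply_of_ne_of_ne (fun h => ha ⟨k, h⟩) (fun h => hb ⟨k, h⟩)]
  · rintro (⟨i, hi, huniq⟩ | ⟨i, j, hij, h⟩)
    · refine ⟨x i, x' i, ?_⟩
      ext k
      simp only [Function.Embedding.smul_apply, Equiv.Perm.smul_def]
      by_cases hk : k = i
      · simp [hk]
      · have hkx : x k = x' k := by
          by_contra hc
          exact hk (huniq k hc)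
        rw [Equiv.swap_apply_of_ne_of_ne (fun h => hk (x.injective h))
          (fun h => hk (x'.injective (hkx ▸ h))), hkx]
    · refine ⟨x i, x j, ?_⟩
      ext k
      simp only [Function.Embedding.smul_apply, Equiv.Perm.smul_def]
      rw [h k, x.injective.swap_apply]

/-- An unordered pair is determined by the nontrivial effect of its transposition on `x`: an entry
of `x` moved by it is one element of the pair, and its image is the other. -/
theorem swap_smul_eq_iff {x : LEPState n ℓ} {a b : Fin n} (hab : Equiv.swap a b • x ≠ x)
    (c d : Fin n) :
    Equiv.swap c d • x = Equiv.swap a b • x ↔ c = a ∧ d = b ∨ c = b ∧ d = a := by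
  constructor
  · intro h
    obtain ⟨i, hi⟩ : ∃ i, Equiv.swap a b (x i) ≠ x i := by
      by_contra hc
      push Not at hc
      exact hab (Function.Embedding.ext hc)
    have h' : Equiv.swap c d (x i) = Equiv.swap a b (x i) := DFunLike.congr_fun h i
    grind
  · rintro (⟨rfl, rfl⟩ | ⟨rfl, rfl⟩)
    · rfl
    · rw [Equiv.swap_comm]

theorem sum_swap_smul_eq_self (x : LEPState n ℓ) :
    ∑ a : Fin n, ∑ b : Fin n, (if Equiv.swap a b • x = x then (1 : ℝ) else 0)
      = ℓ + ((n : ℝ) - ℓ) ^ 2 := by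
  rw [sum_pairs_eq x]
  have h1 : ∀ i j, (if Equiv.swap (x i) (x j) • x = x then (1 : ℝ) else 0)
      = if i = j then 1 else 0 := by
    intro i j
    congr 1
    refine propext ⟨fun h => ?_, fun h => by subst h; rw [Equiv.swap_self]; rfl⟩
    have := DFunLike.congr_fun h i
    simpa [eq_comm] using this
  have h2 : ∀ i, ∀ b ∈ Finset.univ.filter (fun b => b ∉ Set.range x),
      ((if Equiv.swap (x i) b • x = x then (1 : ℝ) else 0)
        + if Equiv.swap b (x i) • x = x then (1 : ℝ) else 0) = 0 := by
    intro i b hb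
    have hb' : b ∉ Set.range x := (Finset.mem_filter.1 hb).2
    have : ¬ Equiv.swap (x i) b • x = x := fun h => by
      have := DFunLike.congr_fun h i
      simp only [Function.Embedding.smul_apply, Equiv.Perm.smul_def, Equiv.swap_apply_left] at this
      exact hb' ⟨i, this.symm⟩
    rw [Equiv.swap_comm b, if_neg this, add_zero]
  have h3 : ∀ a ∈ Finset.univ.filter (fun b => b ∉ Set.range x),
      ∀ b ∈ Finset.univ.filter (fun b => b ∉ Set.range x),
      (if Equiv.swap a b • x = x then (1 : ℝ) else 0) = 1 := by
    intro a ha b hb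
    rw [if_pos]
    ext k
    simp only [Function.Embedding.smul_apply, Equiv.Perm.smul_def]
    rw [Equiv.swap_apply_of_ne_of_ne (fun h => (Finset.mem_filter.1 ha).2 ⟨k, h⟩)
      (fun h => (Finset.mem_filter.1 hb).2 ⟨k, h⟩)]
  rw [Finset.sum_congr rfl fun a ha => Finset.sum_congr rfl fun b hb => h3 a ha b hb,
    Finset.sum_congr rfl fun i _ => Finset.sum_congr rfl fun b hb => h2 i b hb]
  simp only [h1, Finset.sum_const, nsmul_eq_mul, card_filter_notMem_range, Fintype.card_fin]
  simp
  ring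

theorem lepGenerator_apply (α : ℝ) (x x' : LEPState n ℓ) :
    lepGenerator n ℓ α x x' = α / 2 * ∑ a : Fin n, ∑ b : Fin n,
      ((if Equiv.swap a b • x = x' then (1 : ℝ) else 0) - if x = x' then 1 else 0) := by
  classical
  unfold lepGenerator
  by_cases hxx : x = x'
  · subst hxx
    simp only [if_true, Finset.sum_sub_distrib]
    rw [sum_swap_smul_eq_self, Nat.cast_choose_two]
    simp
    ring
  · simp only [hxx, if_false, sub_zero]
    split_ifs with h <;> rw [← exists_swap_smul_eq_iff hxx] at h
    · obtain ⟨a, b, rfl⟩ := h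
      have hab : a ≠ b := fun h => hxx (by subst h; rw [Equiv.swap_self]; rfl)
      have hiff := swap_smul_eq_iff (Ne.symm hxx)
      have : ∀ c d : Fin n, (if Equiv.swap c d • x = Equiv.swap a b • x then (1 : ℝ) else 0)
          = (if c = a then 1 else 0) * (if d = b then 1 else 0)
            + (if c = b then 1 else 0) * (if d = a then 1 else 0) := by
        intro c d
        rw [if_congr (hiff c d) rfl rfl]
        grind
      rw [Finset.sum_congr rfl fun c _ => Finset.sum_congr rfl fun d _ => this c d]
      simp only [Finset.sum_add_distrib, ← Finset.mul_sum, Finset.sum_ite_eq',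
        Finset.mem_univ, if_true, mul_one]
      ring
    · have : ∀ a b : Fin n, ¬ Equiv.swap a b • x = x' := fun a b hab => h ⟨a, b, hab⟩
      simp [this]

theorem lepGenerator_mulVec (α : ℝ) (f : LEPState n ℓ → ℝ) (x : LEPState n ℓ) :
    (lepGenerator n ℓ α *ᵥ f) x
      = α / 2 * ∑ a : Fin n, ∑ b : Fin n, (f (Equiv.swap a b • x) - f x) := by
  simp only [Matrix.mulVec, dotProduct, lepGenerator_apply, mul_assoc, ← Finset.mul_sum,
    Finset.sum_mul]
  congr 1
  rw [Finset.sum_comm]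
  refine Finset.sum_congr rfl fun a _ => ?_
  rw [Finset.sum_comm]
  refine Finset.sum_congr rfl fun b _ => ?_
  simp [sub_mul, Finset.sum_sub_distrib]

theorem lepGenerator_smul_smul (α : ℝ) (σ : Equiv.Perm (Fin n)) (x x' : LEPState n ℓ) :
    lepGenerator n ℓ α (σ • x) (σ • x') = lepGenerator n ℓ α x x' := by
  have h1 : ∀ a b : Fin n, (Equiv.swap (σ a) (σ b) • σ • x = σ • x') = (Equiv.swap a b • x = x') := by
    intro a b
    rw [smul_smul, Equiv.swap_apply_apply, mul_assoc, mul_assoc, inv_mul_cancel, mul_one,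
      mul_smul, smul_left_cancel_iff]
  rw [lepGenerator_apply, lepGenerator_apply]
  congr 1
  rw [← Equiv.sum_comp σ]
  refine Finset.sum_congr rfl fun a _ => ?_
  rw [← Equiv.sum_comp σ]
  refine Finset.sum_congr rfl fun b _ => ?_
  simp only [h1, smul_left_cancel_iff]

theorem lepGenerator_isHermitian (n ℓ : ℕ) (α : ℝ) : (lepGenerator n ℓ α).IsHermitian := by
  ext x x'
  simp only [Matrix.conjTranspose_apply, star_trivial, lepGenerator_apply]
  congr 1
  refine Finset.sum_congr rfl fun a _ => Finset.sum_congr rfl fun b _ => ?_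
  have : (Equiv.swap a b • x' = x) = (Equiv.swap a b • x = x') := by
    refine propext ⟨fun h => ?_, fun h => ?_⟩ <;>
    · rw [← h, smul_smul, Equiv.swap_mul_self, one_smul]
  simp only [this, eq_comm (a := x')]

theorem lepGenerator_mulVec_one (α : ℝ) :
    lepGenerator n ℓ α *ᵥ (fun _ => 1) = 0 := by
  ext x
  simp [lepGenerator_mulVec]

theorem exists_perm_smul_eq (x x' : LEPState n ℓ) : ∃ σ : Equiv.Perm (Fin n), σ • x = x' :=
  (Equiv.Perm.isMultiplyPretransitive (Fin n) ℓ).exists_smul_eq x x'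

end Generator

/-! ### Marginals and the spectrum of the generator -/

section TopLevel

variable {ι : Type*} [DecidableEq ι] {n : ℕ}

theorem swap_comp_eq_update (y : ι ↪ Fin n) (i : ι) {b : Fin n} (hb : b ∉ Set.range y) :
    Equiv.swap (y i) b ∘ y = Function.update y i b := by
  ext k : 1
  by_cases hk : k = i
  · subst hk; simp
  · rw [Function.update_of_ne hk, Function.comp_apply,
      Equiv.swap_apply_of_ne_of_ne (fun h => hk (y.injective h)) (fun h => hb ⟨k, h⟩)]

variable [Fintype ι] {g : (ι → Fin n) → ℝ}

/-- In the vanishing sum over the coordinate `i`, an occupied vertex other than `y i` gives a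
noninjective placement, so the sum over free vertices is minus the term of `y i`. -/
theorem sum_update_notMem_range (hinj : ∀ y, ¬ Function.Injective y → g y = 0)
    (hsum : ∀ y i, ∑ v, g (Function.update y i v) = 0) (y : ι ↪ Fin n) (i : ι) :
    ∑ b with b ∉ Set.range y, g (Function.update y i b) = - g y := by
  have h := hsum y i
  rw [sum_eq_sum_range_add_sum_notMem y, Finset.sum_eq_single i, Function.update_eq_self] at h
  · linarith
  · intro k _ hk
    refine hinj _ fun hc => hk (hc ?_)
    rw [Function.update_self, Function.update_of_ne hk]
  · simp

theorem transpositionOp_apply_embedding (hinj : ∀ y, ¬ Function.Injective y → g y = 0)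
    (hsum : ∀ y i, ∑ v, g (Function.update y i v) = 0) (y : ι ↪ Fin n) :
    transpositionOp g y = ∑ i, ∑ j, g (y ∘ Equiv.swap i j)
      + ((Fintype.card ι : ℝ) ^ 2 - 2 * Fintype.card ι - 2 * n * Fintype.card ι) * g y := by
  have h1 : ∀ i j, g (Equiv.swap (y i) (y j) ∘ y) = g (y ∘ Equiv.swap i j) := by
    intro i j
    congr 1
    ext k : 1
    exact y.injective.swap_apply i j k
  have h2 : ∀ i, ∑ b with b ∉ Set.range y,
      (g (Equiv.swap (y i) b ∘ y) + g (Equiv.swap b (y i) ∘ y)) = - 2 * g y := by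
    intro i
    rw [Finset.sum_congr rfl fun b hb => by
      rw [Equiv.swap_comm b, swap_comp_eq_update y i (Finset.mem_filter.1 hb).2],
      Finset.sum_add_distrib, sum_update_notMem_range hinj hsum]
    ring
  have h3 : ∀ a ∈ Finset.univ.filter (fun b => b ∉ Set.range y),
      ∀ b ∈ Finset.univ.filter (fun b => b ∉ Set.range y), g (Equiv.swap a b ∘ y) = g y := by
    intro a ha b hb
    congr 1
    ext k : 1
    exact Equiv.swap_apply_of_ne_of_ne (fun h => (Finset.mem_filter.1 ha).2 ⟨k, h⟩)
      (fun h => (Finset.mem_filter.1 hb).2 ⟨k, h⟩)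
  unfold transpositionOp
  simp only [Finset.sum_sub_distrib]
  rw [sum_pairs_eq y, Finset.sum_congr rfl fun i _ => h2 i,
    Finset.sum_congr rfl fun a ha => Finset.sum_congr rfl fun b hb => h3 a ha b hb]
  simp only [h1, Finset.sum_const, nsmul_eq_mul, card_filter_notMem_range, Finset.card_univ,
    Fintype.card_fin]
  ring

/-- The spectral bound at the top level. With `j` balls, the vanishing of all sums over one
coordinate turns the operator into `j² - 2j - 2nj` plus a sum of `j²` interchanges of balls, and
at a maximum of `|g|` the latter is at most `j² |g|`. -/
theorem eigenvalue_le_of_sum_update_eq_zero (hinj : ∀ y, ¬ Function.Injective y → g y = 0)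
    (hsum : ∀ y i, ∑ v, g (Function.update y i v) = 0) (hg : g ≠ 0) {μ : ℝ}
    (hμ : ∀ y, transpositionOp g y = μ * g y) :
    μ ≤ - (2 * Fintype.card ι * (n - Fintype.card ι + 1)) := by
  obtain ⟨y₁, hy₁⟩ := Function.ne_iff.1 hg
  have : Nonempty (ι → Fin n) := ⟨y₁⟩
  obtain ⟨y₀, hmax⟩ := Finite.exists_max fun y => |g y|
  have hpos : 0 < |g y₀| := (abs_pos.2 hy₁).trans_le (hmax y₁)
  have hy₀ : Function.Injective y₀ := by
    by_contra hc
    exact abs_pos.1 hpos (hinj _ hc)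
  have hT := transpositionOp_apply_embedding hinj hsum ⟨y₀, hy₀⟩
  simp only [Function.Embedding.coeFn_mk] at hT
  rw [hμ] at hT
  set j : ℝ := (Fintype.card ι : ℝ)
  have hS : |∑ i, ∑ k, g (y₀ ∘ Equiv.swap i k)| ≤ j ^ 2 * |g y₀| := by
    refine (Finset.abs_sum_le_sum_abs _ _).trans ?_
    refine (Finset.sum_le_sum fun i _ => (Finset.abs_sum_le_sum_abs _ _).trans
      (Finset.sum_le_sum fun k _ => hmax _)).trans (le_of_eq ?_)
    simp only [Finset.sum_const, nsmul_eq_mul, Finset.card_univ]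
    ring
  have hE : (μ - (j ^ 2 - 2 * j - 2 * n * j)) * |g y₀| ≤ j ^ 2 * |g y₀| := by
    refine le_trans ?_ hS
    have : ∑ i, ∑ k, g (y₀ ∘ Equiv.swap i k) = (μ - (j ^ 2 - 2 * j - 2 * n * j)) * g y₀ := by
      linarith
    rw [this, abs_mul]
    exact mul_le_mul_of_nonneg_right (le_abs_self _) (abs_nonneg _)
  have := le_of_mul_le_mul_right hE hpos
  linarith

end TopLevel

section Marginal

variable {n ℓ : ℕ}

/-- The marginal of `f` on the balls in `S`: the sum of `f` over all states in which the balls of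
`S` are placed according to `y`. The argument `y` need not be injective; the sum is then empty. -/
noncomputable def marginal (S : Finset (Fin ℓ)) : (LEPState n ℓ → ℝ) →ₗ[ℝ] ((S → Fin n) → ℝ) where
  toFun f y := ∑ x : LEPState n ℓ, if (fun i : S => x i) = y then f x else 0
  map_add' f g := by
    ext y
    simp only [Pi.add_apply, ← Finset.sum_add_distrib]
    refine Finset.sum_congr rfl fun x _ => ?_
    split_ifs <;> simp
  map_smul' c f := by
    ext y
    simp only [Pi.smul_apply, smul_eq_mul, Finset.mul_sum, RingHom.id_apply]
    refine Finset.sum_congr rfl fun x _ => ?_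
    split_ifs <;> simp

theorem marginal_apply (S : Finset (Fin ℓ)) (f : LEPState n ℓ → ℝ) (y : S → Fin n) :
    marginal S f y = ∑ x : LEPState n ℓ, if (fun i : S => x i) = y then f x else 0 := rfl

theorem marginal_comp_smul (S : Finset (Fin ℓ)) (f : LEPState n ℓ → ℝ) (σ : Equiv.Perm (Fin n))
    (y : S → Fin n) : marginal S (fun x => f (σ • x)) y = marginal S f (σ ∘ y) := by
  rw [marginal_apply, marginal_apply, ← Equiv.sum_comp (MulAction.toPerm σ)
    (fun x : LEPState n ℓ => if (fun i : S => x i) = σ ∘ y then f x else 0)]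
  refine Finset.sum_congr rfl fun x _ => ?_
  have : ((fun i : S => (σ • x) i) = σ ∘ y) = ((fun i : S => x i) = y) := by
    refine propext ⟨fun h => ?_, fun h => ?_⟩
    · ext i : 1
      exact σ.injective (congrFun h i)
    · rw [← h]; rfl
  simp only [MulAction.toPerm_apply, this]

/-- Taking marginals intertwines the generator with the transposition operator of fewer balls,
because both are built from permutations of the vertices. -/
theorem marginal_mulVec (α : ℝ) (S : Finset (Fin ℓ)) (f : LEPState n ℓ → ℝ) (y : S → Fin n) :
    marginal S (lepGenerator n ℓ α *ᵥ f) y = α / 2 * transpositionOp (marginal S f) y := by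
  have : lepGenerator n ℓ α *ᵥ f
      = (α / 2) • ∑ a : Fin n, ∑ b : Fin n, ((fun x => f (Equiv.swap a b • x)) - f) := by
    ext x
    simp [lepGenerator_mulVec, Finset.sum_apply]
  rw [this, map_smul, Pi.smul_apply, smul_eq_mul]
  simp only [map_sum, Finset.sum_apply, map_sub, Pi.sub_apply, marginal_comp_smul]
  rfl

theorem marginal_of_not_injective (S : Finset (Fin ℓ)) (f : LEPState n ℓ → ℝ) (y : S → Fin n)
    (hy : ¬ Function.Injective y) : marginal S f y = 0 := by
  rw [marginal_apply]
  refine Finset.sum_eq_zero fun x _ => if_neg fun h => hy ?_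
  rw [← h]
  exact x.injective.comp Subtype.val_injective

theorem sum_marginal_update (S : Finset (Fin ℓ)) (f : LEPState n ℓ → ℝ) (y : S → Fin n) (i : S) :
    ∑ v, marginal S f (Function.update y i v)
      = marginal (S.erase i) f (fun k => y ⟨k, Finset.mem_of_mem_erase k.2⟩) := by
  simp only [marginal_apply]
  rw [Finset.sum_comm]
  refine Finset.sum_congr rfl fun x _ => ?_
  have h : ∀ v, ((fun k : S => x k) = Function.update y i v)
      ↔ v = x i ∧ (fun k : (S.erase i : Finset (Fin ℓ)) => x k)
        = (fun k : (S.erase i : Finset (Fin ℓ)) => y ⟨k, Finset.mem_of_mem_erase k.2⟩) := by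
    intro v
    rw [Function.eq_update_iff, eq_comm (a := v)]
    refine and_congr_right fun _ => ⟨fun h => ?_, fun h k hk => ?_⟩
    · ext k : 1
      exact h ⟨k, Finset.mem_of_mem_erase k.2⟩
        (fun hc => Finset.ne_of_mem_erase k.2 (congrArg Subtype.val hc))
    · exact congrFun h ⟨k, Finset.mem_erase.2 ⟨fun hc => hk (Subtype.ext hc), k.2⟩⟩
  simp only [h, ite_and]
  simp

theorem marginal_univ_apply (f : LEPState n ℓ → ℝ) (x : LEPState n ℓ) :
    marginal Finset.univ f (fun i => x i) = f x := by
  rw [marginal_apply]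
  have : ∀ x' : LEPState n ℓ, ((fun i : (Finset.univ : Finset (Fin ℓ)) => x' i)
      = fun i : (Finset.univ : Finset (Fin ℓ)) => x i) ↔ x' = x := by
    intro x'
    refine ⟨fun h => ?_, fun h => by rw [h]⟩
    ext k : 1
    exact congrFun h ⟨k, Finset.mem_univ k⟩
  simp [this]

/-- An eigenvector all of whose `k`-ball marginals vanish has a first nonvanishing `j`-ball
marginal with `j > k`. That marginal is an eigenfunction of the process with `j` balls whose sums
over one coordinate vanish, so `μ ≤ -α j (n - j + 1)`, and `j (n - j + 1)` increases for
`j ≤ n / 2`. -/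
theorem lepGenerator_eigenvalue_le {α : ℝ} (hα : 0 < α) (hn : 2 * ℓ ≤ n) {k : ℕ} (hk : k < ℓ)
    {f : LEPState n ℓ → ℝ} (hf : f ≠ 0) {μ : ℝ} (hμ : lepGenerator n ℓ α *ᵥ f = μ • f)
    (h0 : ∀ S : Finset (Fin ℓ), S.card = k → marginal S f = 0) :
    μ ≤ - (α * ((k + 1) * (n - k))) := by
  classical
  have hex : ∃ j, k < j ∧ ∃ S : Finset (Fin ℓ), S.card = j ∧ marginal S f ≠ 0 := by
    obtain ⟨x, hx⟩ := Function.ne_iff.1 hf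
    refine ⟨ℓ, hk, Finset.univ, by simp, fun hc => hx ?_⟩
    rw [← marginal_univ_apply f x, hc]
    rfl
  obtain ⟨hkj, S, hS, hSf⟩ := Nat.find_spec hex
  set j := Nat.find hex with hj
  have hzero : ∀ T : Finset (Fin ℓ), T.card = j - 1 → marginal T f = 0 := by
    intro T hT
    by_cases hkj' : k = j - 1
    · exact h0 T (hT.trans hkj'.symm)
    · have := Nat.find_min hex (m := j - 1) (by omega)
      by_contra hc
      exact this ⟨by omega, T, hT, hc⟩
  have hjl : j ≤ ℓ := by
    rw [← hS]
    simpa using Finset.card_le_univ S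
  have hmain := eigenvalue_le_of_sum_update_eq_zero (g := marginal S f) (μ := 2 * μ / α)
    (marginal_of_not_injective S f)
    (fun y i => by
      rw [sum_marginal_update, hzero _ (by rw [Finset.card_erase_of_mem i.2, hS])]
      rfl) hSf
    (fun y => by
      have := marginal_mulVec α S f y
      rw [hμ, map_smul, Pi.smul_apply, smul_eq_mul] at this
      field_simp
      linarith)
  rw [Fintype.card_coe, hS, div_le_iff₀ hα] at hmain
  obtain ⟨d, hd⟩ : ∃ d, j = k + 1 + d := ⟨j - (k + 1), by omega⟩
  have hjR : (j : ℝ) = k + 1 + d := by exact_mod_cast hd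
  have hdn : 2 * ((k : ℝ) + 1 + d) ≤ n := by
    rw [← hjR]
    exact_mod_cast (Nat.mul_le_mul_left 2 hjl).trans hn
  have hcmp : ((k : ℝ) + 1) * (n - k) ≤ j * (n - j + 1) := by
    rw [hjR]
    have : 0 ≤ (d : ℝ) * (n - 2 * k - d - 1) :=
      mul_nonneg (Nat.cast_nonneg d) (by linarith [Nat.cast_nonneg (α := ℝ) d])
    nlinarith
  have := mul_le_mul_of_nonneg_left hcmp hα.le
  nlinarith

/-- The family of all marginals on `k` balls. Its kernel is the orthogonal complement of the
functions that are sums of functions of `k` balls each. -/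
noncomputable def marginals (n ℓ k : ℕ) : (LEPState n ℓ → ℝ) →ₗ[ℝ]
    ((S : Finset.powersetCard k (Finset.univ : Finset (Fin ℓ))) → (S.1 → Fin n) → ℝ) :=
  LinearMap.pi fun S => marginal S.1

theorem marginals_eq_zero_iff {k : ℕ} {f : LEPState n ℓ → ℝ} :
    marginals n ℓ k f = 0 ↔ ∀ S : Finset (Fin ℓ), S.card = k → marginal S f = 0 := by
  refine ⟨fun h S hS => ?_, fun h => ?_⟩
  · exact congrFun h ⟨S, by simp [hS]⟩
  · ext S y
    have := h S.1 (Finset.mem_powersetCard.1 S.2).2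
    simp [marginals, this]

theorem card_eigenvalues_gt_le_choose_mul_pow {α : ℝ} (hα : 0 < α) (hn : 2 * ℓ ≤ n) {k : ℕ}
    (hk : k < ℓ) :
    (Finset.univ.filter fun i =>
      - (α * ((k + 1) * (n - k))) < (lepGenerator_isHermitian n ℓ α).eigenvalues i).card
      ≤ ℓ.choose k * n ^ k := by
  refine ((lepGenerator_isHermitian n ℓ α).card_eigenvalues_gt_le (marginals n ℓ k)
    (fun f hf => ?_) _ (fun f μ hf hμ h0 =>
      lepGenerator_eigenvalue_le hα hn hk hf hμ (marginals_eq_zero_iff.1 h0))).trans (le_of_eq ?_)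
  · rw [marginals_eq_zero_iff] at hf ⊢
    intro S hS
    ext y
    rw [marginal_mulVec, hf S hS]
    simp [transpositionOp]
  · rw [Module.finrank_pi_fintype]
    have : ∀ S : Finset.powersetCard k (Finset.univ : Finset (Fin ℓ)),
        Module.finrank ℝ ((S.1 → Fin n) → ℝ) = n ^ k := by
      intro S
      have := (Finset.mem_powersetCard.1 S.2).2
      simp [this]
    rw [Finset.sum_congr rfl fun S _ => this S]
    simp

end Marginal

/-! ### The stationary distribution and bounds on the trace of the semigroup -/

section Trace

variable {n ℓ : ℕ}

theorem marginal_apply_of_card_eq_zero {S : Finset (Fin ℓ)} (hS : S.card = 0)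
    (f : LEPState n ℓ → ℝ) (y : S → Fin n) : marginal S f y = ∑ x, f x := by
  obtain rfl := Finset.card_eq_zero.1 hS
  rw [marginal_apply]
  exact Finset.sum_congr rfl fun x _ => if_pos (Subsingleton.elim _ _)

theorem lepGenerator_eigenvalue_le_of_sum_eq_zero {α : ℝ} (hα : 0 < α) (hn : 2 * ℓ ≤ n)
    (hℓ : 1 ≤ ℓ) {f : LEPState n ℓ → ℝ} (hf : f ≠ 0) {μ : ℝ}
    (hμ : lepGenerator n ℓ α *ᵥ f = μ • f) (hsum : ∑ x, f x = 0) : μ ≤ - (α * n) := by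
  have := lepGenerator_eigenvalue_le hα hn (k := 0) hℓ hf hμ fun S hS => by
    ext y
    rw [marginal_apply_of_card_eq_zero hS, hsum]
    rfl
  simpa using this

theorem eq_uniform_of_isStationaryDistribution {α : ℝ} (hα : 0 < α) (hn : 2 * ℓ ≤ n)
    (hℓ : 1 ≤ ℓ) {π : LEPState n ℓ → ℝ} (hπ : IsStationaryDistribution (lepGenerator n ℓ α) π) :
    π = fun _ => (Fintype.card (LEPState n ℓ) : ℝ)⁻¹ := by
  obtain ⟨⟨-, hsum⟩, hQ⟩ := hπ
  have hne : Nonempty (LEPState n ℓ) := by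
    by_contra hc
    rw [not_nonempty_iff] at hc
    simp at hsum
  have hM : (Fintype.card (LEPState n ℓ) : ℝ) ≠ 0 :=
    Nat.cast_ne_zero.2 Fintype.card_ne_zero
  have hQ' : lepGenerator n ℓ α *ᵥ π = 0 := by
    rw [← (lepGenerator_isHermitian n ℓ α).eq, Matrix.conjTranspose_eq_transpose_of_trivial,
      Matrix.mulVec_transpose, hQ]
  rw [← sub_eq_zero]
  by_contra hf
  have h1 : lepGenerator n ℓ α *ᵥ (π - fun _ => (Fintype.card (LEPState n ℓ) : ℝ)⁻¹)
      = (0 : ℝ) • (π - fun _ => (Fintype.card (LEPState n ℓ) : ℝ)⁻¹) := by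
    have : (fun _ : LEPState n ℓ => (Fintype.card (LEPState n ℓ) : ℝ)⁻¹)
        = (Fintype.card (LEPState n ℓ) : ℝ)⁻¹ • fun _ => (1 : ℝ) := by
      ext; simp
    rw [Matrix.mulVec_sub, hQ', this, Matrix.mulVec_smul, lepGenerator_mulVec_one]
    simp
  have h2 := lepGenerator_eigenvalue_le_of_sum_eq_zero hα hn hℓ hf h1 (by
    simp only [Pi.sub_apply, Finset.sum_sub_distrib, hsum]
    rw [Finset.sum_const, Finset.card_univ, nsmul_eq_mul, mul_inv_cancel₀ hM, sub_self])
  have h3 : (0 : ℝ) < n := by exact_mod_cast (by omega : 0 < n)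
  have := mul_pos hα h3
  linarith

theorem lepGenerator_eigenvalues_nonpos {α : ℝ} (hα : 0 < α) (hn : 2 * ℓ ≤ n) (hℓ : 1 ≤ ℓ)
    (i : LEPState n ℓ) : (lepGenerator_isHermitian n ℓ α).eigenvalues i ≤ 0 := by
  set hA := lepGenerator_isHermitian n ℓ α
  set v : LEPState n ℓ → ℝ := ⇑(hA.eigenvectorBasis i)
  have hv : lepGenerator n ℓ α *ᵥ v = hA.eigenvalues i • v := hA.mulVec_eigenvectorBasis i
  have hv0 : v ≠ 0 := fun h => hA.eigenvectorBasis.orthonormal.ne_zero i (by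
    ext x
    exact congrFun h x)
  by_cases hsum : ∑ x, v x = 0
  · refine (lepGenerator_eigenvalue_le_of_sum_eq_zero hα hn hℓ hv0 hv hsum).trans ?_
    have := mul_nonneg hα.le (Nat.cast_nonneg (α := ℝ) n)
    linarith
  · have h1 : (fun _ => (1 : ℝ)) ⬝ᵥ (lepGenerator n ℓ α *ᵥ v) = 0 := by
      rw [Matrix.dotProduct_mulVec, ← Matrix.mulVec_transpose,
        ← Matrix.conjTranspose_eq_transpose_of_trivial, hA.eq, lepGenerator_mulVec_one,
        zero_dotProduct]
    rw [hv, dotProduct_smul] at h1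
    have h2 : (fun _ => (1 : ℝ)) ⬝ᵥ v = ∑ x, v x := by simp [dotProduct]
    rw [h2, smul_eq_mul] at h1
    exact ((mul_eq_zero.1 h1).resolve_right hsum).le

/-- Each eigenvalue `μ` is charged to the last `k` with `μ ≤ -α k (n - k + 1)`; at most
`(ℓ choose k) n ^ k` eigenvalues are charged to `k`. -/
theorem sum_exp_eigenvalues_le {α : ℝ} (hα : 0 < α) (hn : 2 * ℓ ≤ n) (hℓ : 1 ≤ ℓ) {s : ℝ}
    (hs : 0 ≤ s) :
    ∑ i, Real.exp (s * (lepGenerator_isHermitian n ℓ α).eigenvalues i)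
      ≤ ∑ k ∈ Finset.range (ℓ + 1),
        (ℓ.choose k * n ^ k : ℝ) * Real.exp (- (s * (α * (k * (n - k + 1))))) := by
  classical
  set μ := (lepGenerator_isHermitian n ℓ α).eigenvalues with hμ
  set γ : ℕ → ℝ := fun k => α * (k * (n - k + 1)) with hγ
  have hγs : ∀ k : ℕ, γ (k + 1) = α * ((k + 1) * (n - k)) := by
    intro k
    simp only [hγ]
    push_cast
    ring
  have hterm : ∀ i, Real.exp (s * μ i) ≤ ∑ k ∈ Finset.range (ℓ + 1),
      if k = ℓ ∨ - γ (k + 1) < μ i then Real.exp (- (s * γ k)) else 0 := by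
    intro i
    -- The last `k ≤ ℓ` with `μ i ≤ -γ k`; it exists since `μ i ≤ 0 = -γ 0`.
    set k := Nat.findGreatest (fun k => μ i ≤ - γ k) ℓ with hk
    have h0 : μ i ≤ - γ 0 := by
      simpa [hγ] using lepGenerator_eigenvalues_nonpos hα hn hℓ i
    have hkspec : μ i ≤ - γ k :=
      Nat.findGreatest_spec (P := fun k => μ i ≤ - γ k) (Nat.zero_le ℓ) h0
    have hkl : k ≤ ℓ := Nat.findGreatest_le ℓ
    have hcond : k = ℓ ∨ - γ (k + 1) < μ i := by
      rcases hkl.eq_or_lt with h | h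
      · exact Or.inl h
      · refine Or.inr (not_le.1 ?_)
        exact Nat.findGreatest_is_greatest (P := fun k => μ i ≤ - γ k) (Nat.lt_succ_self k) h
    refine le_trans ?_ (Finset.single_le_sum (fun k _ => ?_)
      (Finset.mem_range.2 (Nat.lt_succ_of_le hkl)))
    · rw [if_pos hcond, Real.exp_le_exp]
      nlinarith
    · split_ifs
      · exact (Real.exp_pos _).le
      · exact le_rfl
  refine (Finset.sum_le_sum fun i _ => hterm i).trans ?_
  rw [Finset.sum_comm]
  refine Finset.sum_le_sum fun k hk => ?_
  rw [← Finset.sum_filter, Finset.sum_const, nsmul_eq_mul]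
  refine mul_le_mul_of_nonneg_right ?_ (Real.exp_pos _).le
  have hkl : k ≤ ℓ := Nat.lt_succ_iff.1 (Finset.mem_range.1 hk)
  rcases hkl.eq_or_lt with rfl | h
  · have : Fintype.card (LEPState n k) ≤ n ^ k := by
      rw [Fintype.card_embedding_eq, Fintype.card_fin, Fintype.card_fin]
      exact Nat.descFactorial_le_pow n k
    simp only [true_or, Finset.filter_true, Finset.card_univ, Nat.choose_self, Nat.cast_one,
      one_mul]
    exact_mod_cast this
  · have := card_eigenvalues_gt_le_choose_mul_pow hα hn h
    simp only [h.ne, false_or, hγs]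
    exact_mod_cast this

/-- The map sending an `ℓ × n` matrix to the vector of its row sums. -/
noncomputable def rowSums (n ℓ : ℕ) : (Fin ℓ → Fin n → ℝ) →ₗ[ℝ] (Fin ℓ → ℝ) :=
  LinearMap.pi fun i : Fin ℓ =>
    ∑ v : Fin n, (LinearMap.proj v : (Fin n → ℝ) →ₗ[ℝ] ℝ) ∘ₗ LinearMap.proj i

/-- The function `x ↦ ∑ i, c i (x i)` attached to a matrix `c` whose rows sum to zero. These
functions are eigenfunctions with eigenvalue `-α n`, and there are `ℓ (n - 1)` independent
ones. -/
noncomputable def oneBallFunction (n ℓ : ℕ) :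
    LinearMap.ker (rowSums n ℓ)
      →ₗ[ℝ] (LEPState n ℓ → ℝ) :=
  (LinearMap.pi fun x : LEPState n ℓ =>
    ∑ i : Fin ℓ, (LinearMap.proj (x i) : (Fin n → ℝ) →ₗ[ℝ] ℝ) ∘ₗ LinearMap.proj i) ∘ₗ
      Submodule.subtype _

theorem oneBallFunction_apply
    (c : LinearMap.ker (rowSums n ℓ)) (x : LEPState n ℓ) :
    oneBallFunction n ℓ c x = ∑ i, c.1 i (x i) := by
  simp [oneBallFunction, LinearMap.sum_apply]

theorem sum_row_eq_zero (c : LinearMap.ker (rowSums n ℓ)) (i : Fin ℓ) : ∑ v, c.1 i v = 0 := by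
  have := congrFun (LinearMap.mem_ker.1 c.2) i
  simpa [rowSums, LinearMap.sum_apply] using this

theorem sum_swap_apply_sub (c : Fin n → ℝ) (hc : ∑ v, c v = 0) (v : Fin n) :
    ∑ a, ∑ b, (c (Equiv.swap a b v) - c v) = - (2 * n * c v) := by
  have h : ∀ a b, c (Equiv.swap a b v) - c v
      = (if a = v then c b - c v else 0) + (if b = v then c a - c v else 0) := by
    intro a b
    by_cases ha : a = v
    · subst ha
      by_cases hb : b = a
      · subst hb; simp
      · simp [hb]
    · by_cases hb : b = v
      · subst hb; simp [ha]
      · rw [Equiv.swap_apply_of_ne_of_ne (Ne.symm ha) (Ne.symm hb)]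
        simp [ha, hb]
  simp only [h, Finset.sum_add_distrib, Finset.sum_ite_eq', Finset.mem_univ, if_true]
  rw [Finset.sum_comm]
  simp [hc]
  ring

theorem lepGenerator_mulVec_oneBallFunction (α : ℝ) (c) :
    lepGenerator n ℓ α *ᵥ oneBallFunction n ℓ c = (- (α * n)) • oneBallFunction n ℓ c := by
  ext x
  rw [lepGenerator_mulVec, Pi.smul_apply, smul_eq_mul]
  simp only [oneBallFunction_apply, ← Finset.sum_sub_distrib, Function.Embedding.smul_apply,
    Equiv.Perm.smul_def]
  rw [Finset.sum_congr rfl fun a _ => Finset.sum_comm, Finset.sum_comm,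
    Finset.sum_congr rfl fun i _ => sum_swap_apply_sub (c.1 i) (sum_row_eq_zero c i) (x i)]
  rw [Finset.mul_sum, Finset.mul_sum]
  refine Finset.sum_congr rfl fun i _ => ?_
  ring

/-- Moving ball `i` from `v` to a free vertex `w` changes the value by `c i w - c i v`. -/
theorem oneBallFunction_injective (h : ℓ < n) : Function.Injective (oneBallFunction n ℓ) := by
  rw [injective_iff_map_eq_zero]
  intro c hc
  have hval : ∀ x : LEPState n ℓ, ∑ i, c.1 i (x i) = 0 := by
    intro x
    rw [← oneBallFunction_apply, hc]
    rfl
  let x₀ : LEPState n ℓ := Fin.castLEEmb h.le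
  obtain ⟨b, hb⟩ : ∃ b, b ∉ Set.range x₀ := ⟨⟨ℓ, h⟩, by
    rintro ⟨i, hi⟩
    have := congrArg Fin.val hi
    simp [x₀] at this
    omega⟩
  have hconst : ∀ i v w, v ≠ w → c.1 i v = c.1 i w := by
    intro i v w hvw
    have hx₀b : x₀ i ≠ b := fun hi => hb ⟨i, hi⟩
    obtain ⟨σ, hσv, hσw⟩ :=
      (MulAction.is_two_pretransitive_iff (G := Equiv.Perm (Fin n)) (α := Fin n)).1
        (Equiv.Perm.isMultiplyPretransitive (Fin n) 2) hx₀b hvw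
    have hxi : (σ • x₀) i = v := hσv
    have hw : w ∉ Set.range (σ • x₀) := by
      rintro ⟨k, hk⟩
      rw [← hσw] at hk
      exact hb ⟨k, σ.injective hk⟩
    have h1 := hval (σ • x₀)
    have h2 := hval (Equiv.swap v w • σ • x₀)
    have hx' : ⇑(Equiv.swap v w • σ • x₀) = Function.update (σ • x₀) i w := by
      rw [← swap_comp_eq_update (σ • x₀) i hw, hxi]
      rfl
    rw [← Finset.add_sum_erase _ _ (Finset.mem_univ i)] at h1 h2
    have h3 : ∑ k ∈ Finset.univ.erase i, c.1 k ((Equiv.swap v w • σ • x₀) k)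
        = ∑ k ∈ Finset.univ.erase i, c.1 k ((σ • x₀) k) := by
      refine Finset.sum_congr rfl fun k hk => ?_
      rw [hx', Function.update_of_ne (Finset.ne_of_mem_erase hk)]
    rw [h3, hx', Function.update_self] at h2
    rw [hxi] at h1
    linarith
  refine Subtype.ext (funext fun i => funext fun v => ?_)
  have hall : ∀ w, c.1 i w = c.1 i v := fun w => by
    by_cases hvw : w = v
    · rw [hvw]
    · exact hconst i w v hvw
  have hs := sum_row_eq_zero c i
  simp only [hall, Finset.sum_const, Finset.card_univ, Fintype.card_fin, nsmul_eq_mul] at hs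
  have hn0 : (n : ℝ) ≠ 0 := by exact_mod_cast (by omega : n ≠ 0)
  exact (mul_eq_zero.1 hs).resolve_left hn0

theorem mul_sub_one_le_card_eigenvalues_eq (h : ℓ < n) (α : ℝ) :
    ℓ * (n - 1) ≤ (Finset.univ.filter fun i =>
      (lepGenerator_isHermitian n ℓ α).eigenvalues i = - (α * n)).card := by
  refine le_trans ?_ ((lepGenerator_isHermitian n ℓ α).finrank_le_card_eigenvalues_eq
    (oneBallFunction n ℓ) (oneBallFunction_injective h) _ (lepGenerator_mulVec_oneBallFunction α))
  have h1 := LinearMap.finrank_range_add_finrank_ker (rowSums n ℓ)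
  have h2 := Submodule.finrank_le (LinearMap.range (rowSums n ℓ))
  simp only [Module.finrank_pi_fintype, Module.finrank_self, Finset.sum_const, Finset.card_univ,
    Fintype.card_fin, smul_eq_mul, mul_one] at h1 h2
  rw [Nat.mul_sub_one]
  omega

theorem le_sum_exp_eigenvalues (h : ℓ < n) {α : ℝ} (hα : 0 < α) (s : ℝ) :
    1 + (ℓ : ℝ) * (n - 1) * Real.exp (- (s * (α * n)))
      ≤ ∑ i, Real.exp (s * (lepGenerator_isHermitian n ℓ α).eigenvalues i) := by
  set hA := lepGenerator_isHermitian n ℓ α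
  have hn : 0 < n := by omega
  have hne : Nonempty (LEPState n ℓ) := ⟨Fin.castLEEmb h.le⟩
  have h0 : 1 ≤ (Finset.univ.filter fun i => hA.eigenvalues i = 0).card := by
    have := hA.finrank_le_card_eigenvalues_eq
      (LinearMap.toSpanSingleton ℝ (LEPState n ℓ → ℝ) fun _ => 1)
      (by
        intro a b hab
        have := congrFun hab (Fin.castLEEmb h.le)
        simpa using this) 0 (fun w => by
        rw [LinearMap.toSpanSingleton_apply, Matrix.mulVec_smul, lepGenerator_mulVec_one]
        simp)
    simpa using this
  have h1 := mul_sub_one_le_card_eigenvalues_eq h α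
  have hα' : 0 < α * n := mul_pos hα (by exact_mod_cast hn)
  have hdisj : Disjoint (Finset.univ.filter fun i => hA.eigenvalues i = 0)
      (Finset.univ.filter fun i => hA.eigenvalues i = - (α * n)) := by
    rw [Finset.disjoint_filter]
    intro i _ h1 h2
    rw [h1] at h2
    linarith
  refine le_trans ?_ (Finset.sum_le_sum_of_subset_of_nonneg
    (Finset.subset_univ ((Finset.univ.filter fun i => hA.eigenvalues i = 0) ∪
      (Finset.univ.filter fun i => hA.eigenvalues i = - (α * n))))
    fun i _ _ => (Real.exp_pos _).le)
  rw [Finset.sum_union hdisj]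
  refine add_le_add ?_ ?_
  · rw [Finset.sum_congr rfl fun i hi => by
      rw [(Finset.mem_filter.1 hi).2, mul_zero, Real.exp_zero]]
    simpa using h0
  · rw [Finset.sum_congr rfl fun i hi => by
      rw [(Finset.mem_filter.1 hi).2, mul_neg], Finset.sum_const, nsmul_eq_mul]
    refine mul_le_mul_of_nonneg_right ?_ (Real.exp_pos _).le
    have h2 : ((ℓ * (n - 1) : ℕ) : ℝ) ≤ _ := Nat.cast_le.2 h1
    rw [Nat.cast_mul, Nat.cast_pred hn] at h2
    exact h2

end Trace

/-! ### The sum over levels -/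

section Estimate

open Filter Topology

theorem tendsto_log_mul_exp_neg_mul_log {b : ℝ} (hb : 0 < b) :
    Tendsto (fun n : ℕ => Real.log n * Real.exp (- b * Real.log n)) atTop (𝓝 0) := by
  have h := (tendsto_rpow_mul_exp_neg_mul_atTop_nhds_zero 1 b hb).comp
    (Real.tendsto_log_atTop.comp tendsto_natCast_atTop_atTop)
  simpa [Function.comp_def] using h

/-- The conditions on `n` that make the sum over levels small; `34 = 2 * (18 - 1)` belongs to the
levels `k ≤ 18` treated as small in `level_term_le`. -/
theorem eventually_level_conditions {ε : ℝ} (hε : 0 < ε) :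
    ∀ᶠ n : ℕ in atTop, 11 ≤ n ∧ Real.exp (34 * Real.log n / n) ≤ 11 / 10 ∧
      Real.log n * Real.exp (- ε * Real.log n) ≤ 1 / 20 := by
  refine (eventually_ge_atTop 11).and (Eventually.and ?_ ?_)
  · have h1 : Tendsto (fun n : ℕ => 34 * (Real.log n * Real.exp (- 1 * Real.log n))) atTop
        (𝓝 (34 * 0)) := (tendsto_log_mul_exp_neg_mul_log one_pos).const_mul 34
    have h2 := (Real.continuous_exp.tendsto (34 * 0)).comp h1
    have h3 : Real.exp (34 * 0) < 11 / 10 := by norm_num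
    filter_upwards [h2.eventually_le_const h3, eventually_gt_atTop 0] with n hn hn0
    have hn0' : (0 : ℝ) < n := by exact_mod_cast hn0
    refine le_trans (le_of_eq ?_) hn
    simp only [Function.comp_apply, neg_mul, one_mul, Real.exp_neg, Real.exp_log hn0']
    congr 1
    ring
  · exact (tendsto_log_mul_exp_neg_mul_log hε).eventually_le_const (by norm_num)

/-- For bounded `k` the base of the power is close to one. For larger `k` compare with
`k! ≥ (k / e) ^ k`: the base stays bounded as long as `k ≤ n / (2 log n)`, and beyond that it is at
most a multiple of `n ^ (1 - ε)`, which is where `k ≤ (1 - ε) n / 2` is needed. -/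
theorem level_term_le {ε : ℝ} {n : ℕ} (hn : 11 ≤ n)
    (h1 : Real.exp (34 * Real.log n / n) ≤ 11 / 10)
    (h2 : Real.log n * Real.exp (- ε * Real.log n) ≤ 1 / 20) {k : ℕ} (hk : 1 ≤ k)
    (hkn : (k : ℝ) ≤ (1 - ε) * n / 2) :
    ((n : ℝ) / (n - 1) * Real.exp (2 * (k - 1) * Real.log n / n)) ^ k / k.factorial
      ≤ (5 / 4) ^ k / k.factorial + (1 / 2) ^ k := by
  have hnR : (11 : ℝ) ≤ n := by exact_mod_cast hn
  have hn0 : (0 : ℝ) < n := by linarith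
  have hkR : (1 : ℝ) ≤ k := by exact_mod_cast hk
  have hk0 : (0 : ℝ) < k := by linarith
  have hlog : 0 < Real.log n := Real.log_pos (by linarith)
  have hr : (n : ℝ) / (n - 1) ≤ 11 / 10 := by
    rw [div_le_div_iff₀ (by linarith) (by norm_num)]
    linarith
  have hr0 : 0 < (n : ℝ) / (n - 1) := div_pos hn0 (by linarith)
  set E := Real.exp (2 * (k - 1) * Real.log n / n) with hE
  have hE0 : 0 < E := Real.exp_pos _
  set b := (n : ℝ) / (n - 1) * E with hb
  have hb0 : 0 < b := mul_pos hr0 hE0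
  have hbE : b ≤ 11 / 10 * E := mul_le_mul_of_nonneg_right hr hE0.le
  have hfac : (0 : ℝ) < k.factorial := by exact_mod_cast Nat.factorial_pos k
  have he : Real.exp 1 < 2.7183 := lt_trans Real.exp_one_lt_d9 (by norm_num)
  have he0 : 0 < Real.exp 1 := Real.exp_pos 1
  by_cases hk18 : k ≤ 18
  · have hk18' : (k : ℝ) ≤ 18 := by exact_mod_cast hk18
    have hE1 : E ≤ 11 / 10 := by
      refine le_trans (Real.exp_le_exp.2 ?_) h1
      refine div_le_div_of_nonneg_right ?_ hn0.le
      nlinarith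
    have : b ≤ 5 / 4 := by linarith
    have h3 : b ^ k / k.factorial ≤ (5 / 4) ^ k / k.factorial :=
      div_le_div_of_nonneg_right (pow_le_pow_left₀ hb0.le this k) hfac.le
    have h4 : (0 : ℝ) ≤ (1 / 2) ^ k := by positivity
    linarith
  · have hk19 : (19 : ℝ) ≤ k := by exact_mod_cast (by omega : 19 ≤ k)
    -- With `k! ≥ (k / e) ^ k` this bounds the term by `2 ^ (-k)`.
    have hmain : Real.exp 1 * b ≤ k / 2 := by
      by_cases hmid : 2 * (k - 1) * Real.log n ≤ n
      · have hE1 : E ≤ Real.exp 1 := by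
          refine Real.exp_le_exp.2 ?_
          rw [div_le_one hn0]
          exact hmid
        have h3 : b ≤ 11 / 10 * Real.exp 1 := hbE.trans (by linarith)
        calc Real.exp 1 * b ≤ Real.exp 1 * (11 / 10 * Real.exp 1) :=
              mul_le_mul_of_nonneg_left h3 he0.le
          _ ≤ k / 2 := by nlinarith
      · push Not at hmid
        have hE1 : E ≤ n * Real.exp (- ε * Real.log n) := by
          rw [← Real.exp_log hn0, Real.log_exp, ← Real.exp_add]
          refine Real.exp_le_exp.2 ?_
          rw [div_le_iff₀ hn0]
          nlinarith
        set D := Real.exp (- ε * Real.log n)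
        have hD0 : 0 < D := Real.exp_pos _
        -- Multiply by `log n` and use `2 k log n > n`.
        have h3 : Real.exp 1 * b * Real.log n ≤ k / 2 * Real.log n := by
          calc Real.exp 1 * b * Real.log n ≤ 2.7183 * (11 / 10 * (n * D)) * Real.log n := by
                gcongr
                exact hbE.trans (by gcongr)
            _ = 2.7183 * (11 / 10) * n * (Real.log n * D) := by ring
            _ ≤ 2.7183 * (11 / 10) * n * (1 / 20) := by gcongr
            _ ≤ n / 4 := by linarith
            _ ≤ k / 2 * Real.log n := by nlinarith
        exact le_of_mul_le_mul_right h3 hlog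
    have h3 : b ^ k / k.factorial ≤ (1 / 2) ^ k := by
      have hexp := Real.pow_div_factorial_le_exp (k : ℝ) hk0.le k
      have hexp' : Real.exp (k : ℝ) = Real.exp 1 ^ k := by
        rw [← Real.exp_nat_mul, mul_one]
      calc b ^ k / k.factorial = (b / k) ^ k * ((k : ℝ) ^ k / k.factorial) := by
            rw [div_pow]; field_simp
        _ ≤ (b / k) ^ k * Real.exp 1 ^ k := by
            rw [← hexp']; gcongr
        _ = (Real.exp 1 * b / k) ^ k := by rw [← mul_pow]; ring
        _ ≤ (1 / 2) ^ k := by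
            refine pow_le_pow_left₀ (by positivity) ?_ k
            rw [div_le_iff₀ hk0]
            linarith
    have h4 : (0 : ℝ) ≤ (5 / 4) ^ k / k.factorial := by positivity
    linarith

/-- After replacing `ℓ choose k` by `ℓ ^ k / k!`, the factor `(ℓ (n - 1)) ^ (-k)` in the exponential
cancels the multiplicity up to `(n / (n - 1)) ^ k`. -/
theorem choose_mul_pow_mul_exp_le {n ℓ k : ℕ} (hn : 2 ≤ n) (hℓ : 1 ≤ ℓ) (hℓn : ℓ ≤ n)
    (hk : 1 ≤ k) (hkn : k ≤ n) {c : ℝ} (hc : 0 ≤ c) :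
    (ℓ.choose k * n ^ k : ℝ) *
        Real.exp (- ((Real.log (ℓ * (n - 1)) + 4 * c) * (k * (n - k + 1) / n)))
      ≤ Real.exp (- 4 * c) *
        (((n : ℝ) / (n - 1) * Real.exp (2 * (k - 1) * Real.log n / n)) ^ k / k.factorial) := by
  have hnR : (2 : ℝ) ≤ n := by exact_mod_cast hn
  have hn0 : (0 : ℝ) < n := by linarith
  have hn1 : (0 : ℝ) < n - 1 := by linarith
  have hkR : (1 : ℝ) ≤ k := by exact_mod_cast hk
  have hknR : (k : ℝ) ≤ n := by exact_mod_cast hkn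
  have hℓR : (1 : ℝ) ≤ ℓ := by exact_mod_cast hℓ
  have hℓnR : (ℓ : ℝ) ≤ n := by exact_mod_cast hℓn
  set B : ℝ := ℓ * (n - 1) with hB
  have hB0 : 0 < B := by positivity
  have hlogB : Real.log B ≤ 2 * Real.log n := by
    have : B ≤ (n : ℝ) ^ 2 := by nlinarith
    have := Real.log_le_log hB0 this
    rwa [Real.log_pow, Nat.cast_ofNat] at this
  have hexp : - ((Real.log B + 4 * c) * (k * (n - k + 1) / n))
      ≤ - 4 * c + (k * - Real.log B + k * (2 * (k - 1) * Real.log n / n)) := by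
    have e1 : 1 ≤ (k * (n - k + 1) / n : ℝ) := by
      rw [le_div_iff₀ hn0]
      nlinarith
    have e2 : (k * (n - k + 1) / n : ℝ) = k - k * (k - 1) / n := by
      field_simp
      ring
    have e3 : 0 ≤ (k * (k - 1) / n : ℝ) :=
      div_nonneg (mul_nonneg (by linarith) (by linarith)) hn0.le
    have e4 : (k * (2 * (k - 1) * Real.log n / n) : ℝ) = 2 * Real.log n * (k * (k - 1) / n) := by
      ring
    have e5 : c ≤ c * (k * (n - k + 1) / n) := le_mul_of_one_le_right hc e1
    have e6 := mul_le_mul_of_nonneg_right hlogB e3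
    have e7 : Real.log B * (k * (n - k + 1) / n)
        = k * Real.log B - Real.log B * (k * (k - 1) / n) := by
      rw [e2]; ring
    rw [e4, add_mul, e7]
    linarith
  have hchoose : (ℓ.choose k : ℝ) ≤ (ℓ : ℝ) ^ k / k.factorial := Nat.choose_le_pow_div k ℓ
  calc (ℓ.choose k * n ^ k : ℝ) * Real.exp (- ((Real.log B + 4 * c) * (k * (n - k + 1) / n)))
      ≤ ((ℓ : ℝ) ^ k / k.factorial * n ^ k) *
        Real.exp (- 4 * c + (k * - Real.log B + k * (2 * (k - 1) * Real.log n / n))) := by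
        gcongr
    _ = _ := by
        rw [Real.exp_add, Real.exp_add, Real.exp_nat_mul, Real.exp_nat_mul, Real.exp_neg,
          Real.exp_log hB0, hB]
        set E := Real.exp (2 * (k - 1) * Real.log n / n)
        simp only [mul_pow, div_pow, inv_pow]
        field_simp

theorem level_sum_le {ε : ℝ} {n : ℕ} (hn : 11 ≤ n)
    (h1 : Real.exp (34 * Real.log n / n) ≤ 11 / 10)
    (h2 : Real.log n * Real.exp (- ε * Real.log n) ≤ 1 / 20) {ℓ : ℕ} (hℓ : 1 ≤ ℓ) (hℓn : ℓ ≤ n)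
    (hℓε : (ℓ : ℝ) ≤ (1 - ε) * n / 2) {c : ℝ} (hc : 0 ≤ c) :
    ∑ k ∈ Finset.range (ℓ + 1), (ℓ.choose k * n ^ k : ℝ) *
        Real.exp (- ((Real.log (ℓ * (n - 1)) + 4 * c) * (k * (n - k + 1) / n)))
      ≤ 1 + 4 * Real.exp (- 4 * c) := by
  rw [Finset.sum_range_succ']
  have hterm : ∀ k ∈ Finset.range ℓ, (ℓ.choose (k + 1) * n ^ (k + 1) : ℝ) *
      Real.exp (- ((Real.log (ℓ * (n - 1)) + 4 * c) *
        ((k + 1 : ℕ) * (n - (k + 1 : ℕ) + 1) / n)))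
      ≤ Real.exp (- 4 * c) * ((5 / 4) ^ (k + 1) / (k + 1).factorial + (1 / 2) ^ (k + 1)) := by
    intro k hk
    have hkl : k + 1 ≤ ℓ := Finset.mem_range.1 hk
    have hklR : ((k + 1 : ℕ) : ℝ) ≤ ℓ := Nat.cast_le.2 hkl
    refine (choose_mul_pow_mul_exp_le (by omega) hℓ hℓn (by omega) (hkl.trans hℓn) hc).trans ?_
    exact mul_le_mul_of_nonneg_left
      (level_term_le hn h1 h2 (by omega) (hklR.trans hℓε)) (Real.exp_pos _).le
  have hexp : ∑ k ∈ Finset.range ℓ, (5 / 4 : ℝ) ^ (k + 1) / (k + 1).factorial ≤ 3 := by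
    have h3 := Real.sum_le_exp_of_nonneg (x := 5 / 4) (by norm_num) (ℓ + 1)
    rw [Finset.sum_range_succ'] at h3
    have h4 : Real.exp (5 / 4) ≤ 4 := by
      refine le_of_pow_le_pow_left₀ (n := 4) (by norm_num) (by norm_num) ?_
      rw [← Real.exp_nat_mul]
      have : Real.exp ((4 : ℕ) * (5 / 4)) = Real.exp 1 ^ 5 := by
        rw [← Real.exp_nat_mul]
        norm_num
      rw [this]
      have he : Real.exp 1 ≤ 3 := Real.exp_one_lt_three.le
      refine (pow_le_pow_left₀ (Real.exp_pos 1).le he 5).trans (by norm_num)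
    simp only [pow_zero, Nat.factorial_zero, Nat.cast_one, div_one] at h3
    linarith
  have hgeom : ∑ k ∈ Finset.range ℓ, (1 / 2 : ℝ) ^ (k + 1) ≤ 1 := by
    have := sum_geometric_two_le ℓ
    simp only [pow_succ, ← Finset.sum_mul]
    linarith
  have hsum := Finset.sum_le_sum hterm
  rw [← Finset.mul_sum, Finset.sum_add_distrib] at hsum
  have h0 : ((ℓ.choose 0 : ℝ) * n ^ 0) *
      Real.exp (- ((Real.log (ℓ * (n - 1)) + 4 * c) * ((0 : ℕ) * (n - (0 : ℕ) + 1) / n))) = 1 := by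
    simp
  rw [h0]
  have := mul_le_mul_of_nonneg_left (add_le_add hexp hgeom) (Real.exp_pos (-4 * c)).le
  linarith

end Estimate

/-! ### The `L²` distance and the mixing time -/

theorem l2Dist_lepGenerator_eq_sqrt {n ℓ : ℕ} {α : ℝ} (hα : 0 < α) (hn : 2 * ℓ ≤ n) (hℓ : 1 ≤ ℓ)
    {π : LEPState n ℓ → ℝ} (hπ : IsStationaryDistribution (lepGenerator n ℓ α) π)
    (x₀ : LEPState n ℓ) (t : ℝ) :
    l2Dist (lepGenerator n ℓ α) π x₀ t = Real.sqrt
      (∑ i, Real.exp (2 * t * (lepGenerator_isHermitian n ℓ α).eigenvalues i) - 1) := by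
  rw [eq_uniform_of_isStationaryDistribution hα hn hℓ hπ]
  have : Nonempty (LEPState n ℓ) := ⟨x₀⟩
  refine l2Dist_uniform_eq_sqrt _ (lepGenerator_mulVec_one α) (fun x y => ?_) x₀ t
  obtain ⟨σ, hσ⟩ := exists_perm_smul_eq x y
  exact ⟨MulAction.toPerm σ, hσ, fun z w => lepGenerator_smul_smul α σ z w⟩

theorem exp_le_l2Dist {n ℓ : ℕ} (hn : 2 * ℓ ≤ n) (hℓ : 1 ≤ ℓ) {π : LEPState n ℓ → ℝ}
    (hπ : IsStationaryDistribution (lepGenerator n ℓ (2 / (n : ℝ) ^ 2)) π) (x₀ : LEPState n ℓ)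
    {c t : ℝ} (ht : t = 1 / 4 * (n : ℝ) * Real.log ((ℓ : ℝ) * ((n : ℝ) - 1)) + c * (n : ℝ)) :
    Real.exp (-2 * c) ≤ l2Dist (lepGenerator n ℓ (2 / (n : ℝ) ^ 2)) π x₀ t := by
  have hn2 : (2 : ℝ) ≤ n := by exact_mod_cast (by omega : 2 ≤ n)
  have hn0 : (n : ℝ) ≠ 0 := by linarith
  have hℓR : (1 : ℝ) ≤ ℓ := by exact_mod_cast hℓ
  have hα : 0 < 2 / (n : ℝ) ^ 2 := by positivity
  have hB : 0 < (ℓ : ℝ) * (n - 1) := mul_pos (by linarith) (by linarith)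
  rw [l2Dist_lepGenerator_eq_sqrt hα hn hℓ hπ]
  have h := le_sum_exp_eigenvalues (n := n) (ℓ := ℓ) (by omega) hα (2 * t)
  have h1 : (ℓ : ℝ) * (n - 1) * Real.exp (- (2 * t * (2 / (n : ℝ) ^ 2 * n)))
      = Real.exp (-2 * c) ^ 2 := by
    have e1 : - (2 * t * (2 / (n : ℝ) ^ 2 * n))
        = - Real.log ((ℓ : ℝ) * (n - 1)) + (2 : ℕ) * (-2 * c) := by
      rw [ht]
      field_simp
      push_cast
      ring
    rw [e1, Real.exp_add, Real.exp_neg, Real.exp_log hB, Real.exp_nat_mul, ← mul_assoc,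
      mul_inv_cancel₀ hB.ne', one_mul]
  refine Real.le_sqrt_of_sq_le ?_
  linarith

theorem l2Dist_le {ε : ℝ} {n ℓ : ℕ} (hn11 : 11 ≤ n)
    (h1 : Real.exp (34 * Real.log n / n) ≤ 11 / 10)
    (h2 : Real.log n * Real.exp (- ε * Real.log n) ≤ 1 / 20) (hn : 2 * ℓ ≤ n) (hℓ : 1 ≤ ℓ)
    (hℓε : (ℓ : ℝ) ≤ (1 - ε) * n / 2) {π : LEPState n ℓ → ℝ}
    (hπ : IsStationaryDistribution (lepGenerator n ℓ (2 / (n : ℝ) ^ 2)) π) (x₀ : LEPState n ℓ)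
    {c t : ℝ} (hc : 0 ≤ c)
    (ht : t = 1 / 4 * (n : ℝ) * Real.log ((ℓ : ℝ) * ((n : ℝ) - 1)) + c * (n : ℝ)) :
    l2Dist (lepGenerator n ℓ (2 / (n : ℝ) ^ 2)) π x₀ t ≤ 2 * Real.exp (-2 * c) := by
  have hn2 : (2 : ℝ) ≤ n := by exact_mod_cast (by omega : 2 ≤ n)
  have hn0 : (n : ℝ) ≠ 0 := by linarith
  have hℓR : (1 : ℝ) ≤ ℓ := by exact_mod_cast hℓ
  have hα : 0 < 2 / (n : ℝ) ^ 2 := by positivity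
  have hlog : 0 ≤ Real.log ((ℓ : ℝ) * (n - 1)) := Real.log_nonneg (by nlinarith)
  have ht0 : 0 ≤ 2 * t := by
    rw [ht]
    positivity
  rw [l2Dist_lepGenerator_eq_sqrt hα hn hℓ hπ]
  have h := sum_exp_eigenvalues_le hα hn hℓ ht0
  have hexp : ∀ k : ℕ, 2 * t * (2 / (n : ℝ) ^ 2 * (k * (n - k + 1)))
      = (Real.log (ℓ * (n - 1)) + 4 * c) * (k * (n - k + 1) / n) := by
    intro k
    rw [ht]
    field_simp
    ring
  simp only [hexp] at h
  have h3 := h.trans (level_sum_le hn11 h1 h2 hℓ (by omega) hℓε hc)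
  have h4 : Real.exp (- 4 * c) = Real.exp (-2 * c) ^ 2 := by
    rw [← Real.exp_nat_mul]
    congr 1
    push_cast
    ring
  refine Real.sqrt_le_iff.2 ⟨by positivity, ?_⟩
  rw [mul_pow, ← h4]
  linarith

/-- The two bounds on the `L²` distance pin the mixing time to within a constant multiple of `n`,
since `e ^ (-2c) = 2δ` and `2 e ^ (-2c) = 2δ` have solutions `c` depending only on `δ`. -/
theorem abs_l2MixingTime_sub_le {n : ℕ} {S : Type*} [Fintype S] [DecidableEq S] [Nonempty S]
    {Q : Matrix S S ℝ} {π : S → ℝ} {b δ : ℝ} (hn : 2 ≤ n) (hb : 1 ≤ b) (hδ : 0 < δ) (hδ1 : δ < 1)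
    (hlower : ∀ (x₀ : S) (c t : ℝ),
      t = 1 / 4 * (n : ℝ) * Real.log (b * ((n : ℝ) - 1)) + c * (n : ℝ) → 0 ≤ t →
      Real.exp (-2 * c) ≤ l2Dist Q π x₀ t)
    (hupper : ∀ (x₀ : S) (c t : ℝ), 0 ≤ c →
      t = 1 / 4 * (n : ℝ) * Real.log (b * ((n : ℝ) - 1)) + c * (n : ℝ) →
      l2Dist Q π x₀ t ≤ 2 * Real.exp (-2 * c)) :
    |l2MixingTime Q π δ - 1 / 4 * (n : ℝ) * Real.log (b * (n : ℝ))|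
      ≤ (1 + |Real.log δ| + |Real.log (2 * δ)|) * (n : ℝ) := by
  have hn2 : (2 : ℝ) ≤ n := by exact_mod_cast hn
  have hn0 : (0 : ℝ) < n := by linarith
  have hB : 1 ≤ b * (n - 1) := by nlinarith
  have hlog0 : 0 ≤ Real.log (b * (n - 1)) := Real.log_nonneg hB
  have hlog_le : Real.log (b * (n - 1)) ≤ Real.log (b * n) :=
    Real.log_le_log (by linarith) (by nlinarith)
  have hlog_ge : Real.log (b * n) ≤ Real.log (b * (n - 1)) + 1 := by
    have h1 : b * n ≤ 2 * (b * (n - 1)) := by nlinarith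
    have h2 := Real.log_le_log (by nlinarith) h1
    rw [Real.log_mul (x := 2) (by norm_num) (by linarith)] at h2
    linarith [Real.log_two_lt_d9]
  have hlogδ : Real.log δ < 0 := Real.log_neg hδ hδ1
  set T : Set ℝ := {t : ℝ | 0 ≤ t ∧ ∀ x₀ : S, l2Dist Q π x₀ t ≤ 2 * δ} with hT
  set c₁ : ℝ := - Real.log δ / 2 with hc₁
  have hc₁0 : 0 ≤ c₁ := by linarith
  have hmem : 1 / 4 * (n : ℝ) * Real.log (b * ((n : ℝ) - 1)) + c₁ * n ∈ T := by
    refine ⟨by positivity, fun x₀ => (hupper x₀ c₁ _ hc₁0 rfl).trans (le_of_eq ?_)⟩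
    rw [hc₁, show -2 * (- Real.log δ / 2) = Real.log δ by ring, Real.exp_log hδ]
  have hup : l2MixingTime Q π δ ≤ 1 / 4 * (n : ℝ) * Real.log (b * ((n : ℝ) - 1)) + c₁ * n :=
    csInf_le ⟨0, fun t ht => ht.1⟩ hmem
  have hlow : 1 / 4 * (n : ℝ) * Real.log (b * ((n : ℝ) - 1)) - Real.log (2 * δ) / 2 * n
      ≤ l2MixingTime Q π δ := by
    refine le_csInf ⟨_, hmem⟩ fun t ht => ?_
    obtain ⟨x₀⟩ := ‹Nonempty S›
    have h1 := (hlower x₀ ((t - 1 / 4 * (n : ℝ) * Real.log (b * ((n : ℝ) - 1))) / n) t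
      (by field_simp; ring) ht.1).trans (ht.2 x₀)
    have h2 := (Real.le_log_iff_exp_le (by linarith)).2 h1
    have h3 := mul_le_mul_of_nonneg_right h2 hn0.le
    have h4 : -2 * ((t - 1 / 4 * (n : ℝ) * Real.log (b * ((n : ℝ) - 1))) / n) * n
        = -2 * (t - 1 / 4 * (n : ℝ) * Real.log (b * ((n : ℝ) - 1))) := by
      field_simp
    rw [h4] at h3
    linarith
  have e1 := mul_le_mul_of_nonneg_left hlog_le hn0.le
  have e2 := mul_le_mul_of_nonneg_left hlog_ge hn0.le
  have e3 : c₁ * n ≤ |Real.log δ| * n := by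
    refine mul_le_mul_of_nonneg_right ?_ hn0.le
    rw [abs_of_neg hlogδ]
    linarith
  have e4 : Real.log (2 * δ) / 2 * n ≤ |Real.log (2 * δ)| * n := by
    refine mul_le_mul_of_nonneg_right ?_ hn0.le
    linarith [le_abs_self (Real.log (2 * δ)), abs_nonneg (Real.log (2 * δ))]
  have e5 : 0 ≤ |Real.log δ| * (n : ℝ) := by positivity
  have e6 : 0 ≤ |Real.log (2 * δ)| * (n : ℝ) := by positivity
  rw [abs_le]
  constructor <;> linarith

theorem theorem1p4 :
    ∃ C : ℝ → ℝ, ∀ ε : ℝ, 0 < ε →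
      (∀ n ℓ : ℕ, 1 ≤ ℓ → (ℓ : ℝ) ≤ (1 - ε) * (n : ℝ) / 2 →
        ∀ π : LEPState n ℓ → ℝ,
          IsStationaryDistribution (lepGenerator n ℓ (2 / (n : ℝ) ^ 2)) π →
          ∀ (x₀ : LEPState n ℓ) (c t : ℝ),
            t = 1 / 4 * (n : ℝ) * Real.log ((ℓ : ℝ) * ((n : ℝ) - 1)) + c * (n : ℝ) → 0 ≤ t →
            Real.exp (-2 * c) ≤ l2Dist (lepGenerator n ℓ (2 / (n : ℝ) ^ 2)) π x₀ t) ∧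
      ∃ N : ℕ, ∀ n ℓ : ℕ, N ≤ n → 1 ≤ ℓ → (ℓ : ℝ) ≤ (1 - ε) * (n : ℝ) / 2 →
        ∀ π : LEPState n ℓ → ℝ,
          IsStationaryDistribution (lepGenerator n ℓ (2 / (n : ℝ) ^ 2)) π →
          (∀ (x₀ : LEPState n ℓ) (c t : ℝ), 0 ≤ c →
            t = 1 / 4 * (n : ℝ) * Real.log ((ℓ : ℝ) * ((n : ℝ) - 1)) + c * (n : ℝ) →
            l2Dist (lepGenerator n ℓ (2 / (n : ℝ) ^ 2)) π x₀ t ≤ 2 * Real.exp (-2 * c)) ∧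
          ∀ δ : ℝ, 0 < δ → δ < 1 →
            |l2MixingTime (lepGenerator n ℓ (2 / (n : ℝ) ^ 2)) π δ
                - 1 / 4 * (n : ℝ) * Real.log ((ℓ : ℝ) * (n : ℝ))| ≤ C δ * (n : ℝ) := by
  refine ⟨fun δ => 1 + |Real.log δ| + |Real.log (2 * δ)|, fun ε hε => ?_⟩
  have hsize : ∀ n ℓ : ℕ, (ℓ : ℝ) ≤ (1 - ε) * (n : ℝ) / 2 → 2 * ℓ ≤ n := by
    intro n ℓ h
    have : (2 * ℓ : ℝ) ≤ n := by nlinarith [mul_nonneg hε.le (Nat.cast_nonneg (α := ℝ) n)]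
    exact_mod_cast this
  refine ⟨fun n ℓ hℓ h π hπ x₀ c t ht _ => exp_le_l2Dist (hsize n ℓ h) hℓ hπ x₀ ht, ?_⟩
  obtain ⟨N, hN⟩ := Filter.eventually_atTop.1 (eventually_level_conditions hε)
  refine ⟨N, fun n ℓ hn hℓ h π hπ => ?_⟩
  obtain ⟨hn11, h1, h2⟩ := hN n hn
  have hupper : ∀ (x₀ : LEPState n ℓ) (c t : ℝ), 0 ≤ c →
      t = 1 / 4 * (n : ℝ) * Real.log ((ℓ : ℝ) * ((n : ℝ) - 1)) + c * (n : ℝ) →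
      l2Dist (lepGenerator n ℓ (2 / (n : ℝ) ^ 2)) π x₀ t ≤ 2 * Real.exp (-2 * c) :=
    fun x₀ c t hc ht => l2Dist_le hn11 h1 h2 (hsize n ℓ h) hℓ h hπ x₀ hc ht
  have : Nonempty (LEPState n ℓ) := ⟨Fin.castLEEmb (by have := hsize n ℓ h; omega)⟩
  exact ⟨hupper, fun δ hδ hδ1 => abs_l2MixingTime_sub_le (by omega) (by exact_mod_cast hℓ) hδ hδ1
    (fun x₀ c t ht _ => exp_le_l2Dist (hsize n ℓ h) hℓ hπ x₀ ht) hupper⟩
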